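/- Let $k\ge 0$, let $\beta_0,\dots,\beta_k$ be algebraic numbers with $\beta_m\neq 0$ for some $m\ge 1$, and put $$f(z)=\sum_{m=0}^{k}\bigl(\beta_m z^m+\overline{\beta_m}\,\overline{z}^{\,m}\bigr)\quad(z\in\mathbb C),\qquad g(x)=f(e^{ix})\quad(x\in\mathbb R).$$ The function $f$ is given by the list of standard representations $(p,a,b,r)\in\mathbb Z[x]\times\mathbb Q^3$ of $\beta_0,\dots,\beta_k$: here $p$ is a defining polynomial of the number (an integer polynomial of least degree, with coprime coefficients, vanishing at it; list of coefficients in binary), and the number is the only root of $p$ in the open disc of radius $r$ around $a+bi$. Let $\|f\|$ be the bit length of this description. For a zero $\varphi$ of $g$ let $d\ge 1$ be the least integer with $g^{(d)}(\varphi)\ne 0$ and let $T_\varphi(x)=\frac{g^{(d)}(\varphi)}{d!}(x-\varphi)^d$ be the first nonvanishing Taylor term of $g$ at $\varphi$. Fix $D\in\mathbb N$. There is an algorithm that, given the description of such an $f$ with $[\mathbb Q(\beta_0,\dots,\beta_k):\mathbb Q]\le D$, computes in time polynomial in $\|f\|$ a rational number $\epsilon_1>0$ with $\frac1{\epsilon_1}\le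 2^{\|f\|^{O(1)}}$ such that for every zero $\varphi\in(-\pi,\pi]$ of $g$: 1. the sign of $g'$ does not change in $(\varphi,\varphi+\epsilon_1)$, nor in $(\varphi-\epsilon_1,\varphi)$; 2. $|g(x)-T_\varphi(x)|\le\frac12|T_\varphi(x)|$ for every $x\in(\varphi-\epsilon_1,\varphi+\epsilon_1)$; 3. $\operatorname{sign} g'(x)=\operatorname{sign} T_\varphi'(x)$ for every $x\in(\varphi-\epsilon_1,\varphi+\epsilon_1)$; and moreover $(\varphi-\epsilon_1,\varphi+\epsilon_1)\subseteq(-\pi,\pi)$ if $\varphi\neq\pi$. (The degree of the time bound and the constant in $O(1)$ may depend on $D$ only.) -/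

import Mathlib

noncomputable section

namespace DominantFunction

/-! ### Standard representations of algebraic numbers and their binary encodings -/

/-- Data `(p, a, b, r) ∈ ℤ[x] × ℚ³` intended to describe an algebraic number: a polynomial `p`
and the disc of radius `r` centred at `a + b i`. -/
structure AlgRep where
  poly : Polynomial ℤ
  re : ℚ
  im : ℚ
  rad : ℚ

/-- `p` is a defining polynomial of `α`: it vanishes at `α`, has coprime coefficients, and has
least degree among the nonzero integer polynomials vanishing at `α`. (This determines `p` up to
sign; both signs are admitted.) -/
def IsDefiningPoly (p : Polynomial ℤ) (α : ℂ) : Prop :=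
  p ≠ 0 ∧ p.IsPrimitive ∧ Polynomial.aeval α p = 0 ∧
    ∀ q : Polynomial ℤ, q ≠ 0 → Polynomial.aeval α q = 0 → p.natDegree ≤ q.natDegree

/-- The centre `a + b i` of the isolating disc. -/
def AlgRep.centre (R : AlgRep) : ℂ := (R.re : ℂ) + (R.im : ℂ) * Complex.I

/-- `R = (p, a, b, r)` is a standard representation of `α`: `p` is the defining polynomial of `α`
and `α` is the unique root of `p` inside the circle of radius `r` centred at `a + b i`. -/
def AlgRep.Represents (R : AlgRep) (α : ℂ) : Prop :=
  IsDefiningPoly R.poly α ∧ ‖α - R.centre‖ < (R.rad : ℝ) ∧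
    ∀ z : ℂ, Polynomial.aeval z R.poly = 0 → ‖z - R.centre‖ < (R.rad : ℝ) → z = α

/-- The two-bit code of a binary digit. The first bit `true` distinguishes digits from the
punctuation marks `comma` and `semicolon`. -/
def digit (b : Bool) : List Bool := [true, b]

/-- Two-bit code of the mark that closes an integer. -/
def comma : List Bool := [false, false]

/-- Two-bit code of the mark that closes a list of integers. -/
def semicolon : List Bool := [false, true]

/-- An integer: a sign digit, the binary digits of the absolute value, a comma. -/
def encodeInt (z : ℤ) : List Bool :=
  digit (decide (z < 0)) ++ (Computability.encodeNat z.natAbs).flatMap digit ++ comma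

/-- A rational number in lowest terms: numerator, then denominator, in binary. -/
def encodeRat (q : ℚ) : List Bool := encodeInt q.num ++ encodeInt (q.den : ℤ)

/-- An integer polynomial: the list of its coefficients, from degree `0` to its degree, in
binary. -/
def encodePoly (p : Polynomial ℤ) : List Bool :=
  (List.range (p.natDegree + 1)).flatMap (fun i => encodeInt (p.coeff i)) ++ semicolon

/-- The tuple `(p, a, b, r)` as a bit string. -/
def encodeAlgRep (R : AlgRep) : List Bool :=
  encodePoly R.poly ++ encodeRat R.re ++ encodeRat R.im ++ encodeRat R.rad

/-- Description of a dominant function: representations of its coefficients `β₀, …, β_k`. -/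
structure FunRep where
  k : ℕ
  coeff : Fin (k + 1) → AlgRep

/-- The description of a dominant function as a bit string. -/
def encodeFun (F : FunRep) : List Bool := (List.ofFn F.coeff).flatMap encodeAlgRep

/-- The encoding length `‖f‖`, in bits. -/
def FunRep.size (F : FunRep) : ℕ := (encodeFun F).length

/-! ### The dominant function and its Taylor terms -/

/-- The dominant function `f(z) = ∑_{m=0}^k (β_m z^m + conj β_m * conj z^m)`, a real number since
each summand is the sum of a complex number and its conjugate. -/
def dominant {k : ℕ} (β : Fin (k + 1) → ℂ) (z : ℂ) : ℝ :=
  (∑ m : Fin (k + 1), (β m * z ^ (m : ℕ) +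
    (starRingEnd ℂ) (β m) * ((starRingEnd ℂ) z) ^ (m : ℕ))).re

/-- Taking the real part in `dominant` loses nothing. -/
theorem coe_dominant {k : ℕ} (β : Fin (k + 1) → ℂ) (z : ℂ) :
    (dominant β z : ℂ) = ∑ m : Fin (k + 1), (β m * z ^ (m : ℕ) +
      (starRingEnd ℂ) (β m) * ((starRingEnd ℂ) z) ^ (m : ℕ)) := by
  unfold dominant
  rw [← Complex.conj_eq_iff_re, map_sum]
  refine Finset.sum_congr rfl fun m _ => ?_
  simp [add_comm]

/-- `g(x) = f(e^{ix})`, extended naturally from `(-π, π]` to the whole real line. -/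
def circleFun {k : ℕ} (β : Fin (k + 1) → ℂ) (x : ℝ) : ℝ :=
  dominant β (Complex.exp ((x : ℂ) * Complex.I))

/-- The least `d` such that the `d`-th derivative of `g` at `φ` does not vanish. -/
def firstOrder (g : ℝ → ℝ) (φ : ℝ) : ℕ := sInf {d : ℕ | iteratedDeriv d g φ ≠ 0}

/-- The first nonvanishing Taylor term `T(x) = g^{(d)}(φ) / d! * (x - φ)^d` of `g` at `φ`. -/
def firstTaylor (g : ℝ → ℝ) (φ : ℝ) (x : ℝ) : ℝ :=
  iteratedDeriv (firstOrder g φ) g φ / ((firstOrder g φ).factorial : ℝ) *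
    (x - φ) ^ firstOrder g φ

/-- The requirements on a radius `ε` at a point `φ`. -/
structure GoodRadius (g : ℝ → ℝ) (φ ε : ℝ) : Prop where
  /-- The sign of `g'` does not change in `(φ, φ + ε)`. -/
  sign_right : ∀ x ∈ Set.Ioo φ (φ + ε), ∀ y ∈ Set.Ioo φ (φ + ε),
    SignType.sign (deriv g x) = SignType.sign (deriv g y)
  /-- The sign of `g'` does not change in `(φ - ε, φ)`. -/
  sign_left : ∀ x ∈ Set.Ioo (φ - ε) φ, ∀ y ∈ Set.Ioo (φ - ε) φ,
    SignType.sign (deriv g x) = SignType.sign (deriv g y)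
  /-- `|g - T| ≤ |T| / 2` in `(φ - ε, φ + ε)`. -/
  approx : ∀ x ∈ Set.Ioo (φ - ε) (φ + ε),
    |g x - firstTaylor g φ x| ≤ 1 / 2 * |firstTaylor g φ x|
  /-- `g'` and `T'` have the same sign in `(φ - ε, φ + ε)`. -/
  sign_deriv : ∀ x ∈ Set.Ioo (φ - ε) (φ + ε),
    SignType.sign (deriv g x) = SignType.sign (deriv (firstTaylor g φ) x)

end DominantFunction

end

/-!
Differentiating `g(x) = f(e^{ix})` amounts to applying the Euler operator `θ = z d/dz - k` to the
polynomial `P(z) = z^k f(z)` on the unit circle: `|g^{(n)}(x)| = |(θ^n P)(e^{ix})|`. At a zero `φ`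
of `g` the number `z = e^{iφ}` is a root of `P`, so the values `(θ^n P)(z)` and `z + 1` lie in a
number field of degree at most `2kD²`, and Liouville's inequality (the norm of a nonzero algebraic
integer is at least `1` in absolute value) bounds each nonzero one below by `2^{-O(‖f‖^4)}`. The
operator `θ^n` multiplies the `j`-th coefficient by `(j - k)^n`, so by a Vandermonde argument some
`(θ^n P)(z)` with `n ≤ 2k` is nonzero; hence the first nonvanishing derivative of `g` at `φ` is
bounded below, while the next one is bounded above by `2^{O(‖f‖^2)}`. Taylor's theorem then yields
a good radius `2^{-‖f‖^C}` depending on `‖f‖` alone, and the lower bound for `|z + 1|` keeps `φ`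
away from `±π`. A Turing machine writes this radius down by raising the length of its input to the
power `C`.
-/

namespace DominantFunction

section Machine

open Turing TM2.Stmt

section Run

variable {K Λ σ : Type} {Γ : K → Type} [DecidableEq K]

/-- The machine with program `M` gets from `a` to `b` in at most `t` steps. -/
def RunsIn (M : Λ → TM2.Stmt Γ Λ σ) (a b : TM2.Cfg Γ Λ σ) (t : ℕ) : Prop :=
  Nonempty (StateTransition.EvalsToInTime (TM2.step M) a (some b) t)

variable {M : Λ → TM2.Stmt Γ Λ σ} {a b c : TM2.Cfg Γ Λ σ} {m n : ℕ}

theorem RunsIn.trans (h₁ : RunsIn M a b m) (h₂ : RunsIn M b c n) : RunsIn M a c (m + n) := by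
  obtain ⟨e₁⟩ := h₁
  obtain ⟨e₂⟩ := h₂
  exact ⟨add_comm n m ▸ e₁.trans _ _ _ _ _ _ e₂⟩

theorem RunsIn.of_step_eq (h : TM2.step M a = some b) : RunsIn M a b 1 :=
  ⟨⟨⟨1, h⟩, le_rfl⟩⟩

theorem RunsIn.loop {cfg : ℕ → ℕ → TM2.Cfg Γ Λ σ} {out : ℕ → TM2.Cfg Γ Λ σ} {t₀ t : ℕ}
    (body : ∀ n k, RunsIn M (cfg (n + 1) k) (cfg n (k + 1)) t)
    (exit : ∀ k, RunsIn M (cfg 0 k) (out k) t₀) (n k : ℕ) :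
    RunsIn M (cfg n k) (out (k + n)) (n * t + t₀) := by
  induction n generalizing k with
  | zero => simpa using exit k
  | succ n ih => convert (body n k).trans (ih (k + 1)) using 1 <;> ring_nf

end Run

/-- The statement writing the list `l` on top of the stack `k`. -/
def pushList {K Λ σ : Type} (k : K) (l : List Bool) (q : TM2.Stmt (fun _ : K => Bool) Λ σ) :
    TM2.Stmt (fun _ : K => Bool) Λ σ :=
  l.foldl (fun q b => push k (fun _ => b) q) q

theorem stepAux_pushList {K Λ σ : Type} [DecidableEq K] (k : K) (l : List Bool)
    (q : TM2.Stmt (fun _ : K => Bool) Λ σ) (v : σ) (S : K → List Bool) :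
    TM2.stepAux (pushList k l q) v S = TM2.stepAux q v (Function.update S k (l ++ S k)) := by
  induction l generalizing q with
  | nil => simp [pushList]
  | cons b l ih =>
    rw [pushList, List.foldl_cons, ← pushList, ih]
    simp

/-- The statement removing the top symbol of the stack `k` and continuing with `q₁` if there was
one, with `q₂` if the stack was empty. -/
def popBranch {K Λ : Type} (k : K) (q₁ q₂ : TM2.Stmt (fun _ : K => Bool) Λ Bool) :
    TM2.Stmt (fun _ : K => Bool) Λ Bool :=
  pop k (fun _ o => o.isSome)
    (branch id (load (fun _ => false) q₁) (load (fun _ => false) q₂))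

/-- The labels of `powProgram C`. The index of `test` counts the multiplications that are left to
do; the indices of the four phases of a multiplication count those left to do after it. -/
inductive PowLabel (C : ℕ)
  | read
  | test (i : Fin (C + 1))
  | multiply (j : Fin C)
  | copy (j : Fin C)
  | restore (j : Fin C)
  | move (j : Fin C)
  | clear
  | write
  deriving Fintype

/-- A program replacing a list of length `N` on the stack `0` by the encoding of `1 / 2 ^ N ^ C`.
The other stacks hold numbers in unary: `1` the number `N`, `2` a buffer for it, `3` the current
power of `N`, `4` a product under construction. -/
def powProgram (C : ℕ) : PowLabel C → TM2.Stmt (fun _ : Fin 5 => Bool) (PowLabel C) Bool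
  | .read => popBranch 0 (pushList 1 [true] (goto fun _ => .read))
      (pushList 3 [true] (goto fun _ => .test (Fin.last C)))
  | .test i => goto fun _ => Fin.cases .clear .multiply i
  | .multiply j => popBranch 3 (goto fun _ => .copy j) (goto fun _ => .move j)
  | .copy j => popBranch 1 (pushList 2 [true] (pushList 4 [true] (goto fun _ => .copy j)))
      (goto fun _ => .restore j)
  | .restore j => popBranch 2 (pushList 1 [true] (goto fun _ => .restore j))
      (goto fun _ => .multiply j)
  | .move j => popBranch 4 (pushList 3 [true] (goto fun _ => .move j))
      (goto fun _ => .test j.castSucc)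
  | .clear => popBranch 1 (goto fun _ => .clear)
      (pushList 0 (digit true ++ comma) (goto fun _ => .write))
  | .write => popBranch 3 (pushList 0 (digit false) (goto fun _ => .write))
      (pushList 0 (encodeInt 1 ++ digit false) halt)

/-- The machine with program `powProgram C`. -/
def powMachine (C : ℕ) : FinTM2 where
  K := Fin 5
  k₀ := 0
  k₁ := 0
  Γ _ := Bool
  Λ := PowLabel C
  main := .read
  σ := Bool
  initialState := false
  Γk₀Fin := inferInstanceAs (Fintype Bool)
  m := powProgram C

/-- The configuration of `powMachine C` at the label `l` with `s` on the stack `0` and `n₁`, …,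
`n₄` on the stacks `1`, …, `4`. -/
def powCfg {C : ℕ} (l : Option (PowLabel C)) (s : List Bool) (n₁ n₂ n₃ n₄ : ℕ) :
    TM2.Cfg (fun _ : Fin 5 => Bool) (PowLabel C) Bool :=
  ⟨l, false, ![s, .replicate n₁ true, .replicate n₂ true, .replicate n₃ true, .replicate n₄ true]⟩

theorem update_stacks (s₀ s₁ s₂ s₃ s₄ t : List Bool) :
    Function.update ![s₀, s₁, s₂, s₃, s₄] 0 t = ![t, s₁, s₂, s₃, s₄] ∧
    Function.update ![s₀, s₁, s₂, s₃, s₄] 1 t = ![s₀, t, s₂, s₃, s₄] ∧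
    Function.update ![s₀, s₁, s₂, s₃, s₄] 2 t = ![s₀, s₁, t, s₃, s₄] ∧
    Function.update ![s₀, s₁, s₂, s₃, s₄] 3 t = ![s₀, s₁, s₂, t, s₄] ∧
    Function.update ![s₀, s₁, s₂, s₃, s₄] 4 t = ![s₀, s₁, s₂, s₃, t] := by
  refine ⟨?_, ?_, ?_, ?_, ?_⟩ <;> funext k <;> fin_cases k <;> rfl

variable {C : ℕ} (j : Fin C) (s : List Bool) (N n₁ n₂ n₃ n₄ : ℕ)

theorem runsIn_read :
    RunsIn (powProgram C) (powCfg (some .read) s n₁ n₂ 0 n₄)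
      (powCfg (some (.test (Fin.last C))) [] (n₁ + s.length) n₂ 1 n₄) (s.length + 1) := by
  induction s generalizing n₁ with
  | nil => exact .of_step_eq (by
      simp [powCfg, powProgram, popBranch, stepAux_pushList, update_stacks])
  | cons b s ih =>
    have pop_bit : RunsIn (powProgram C) (powCfg (some .read) (b :: s) n₁ n₂ 0 n₄)
        (powCfg (some .read) s (n₁ + 1) n₂ 0 n₄) 1 := .of_step_eq (by
      simp [powCfg, powProgram, popBranch, stepAux_pushList, update_stacks, List.replicate_succ])
    convert pop_bit.trans (ih (n₁ + 1)) using 1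
    · rw [List.length_cons, add_assoc, add_comm 1]
    · rw [List.length_cons, add_comm 1]

theorem runsIn_copy :
    RunsIn (powProgram C) (powCfg (some (.copy j)) s N 0 n₃ n₄)
      (powCfg (some (.restore j)) s 0 N n₃ (n₄ + N)) (N + 1) := by
  have := RunsIn.loop (M := powProgram C) (t := 1) (t₀ := 1)
    (cfg := fun n k => powCfg (some (.copy j)) s n k n₃ (n₄ + k))
    (out := fun k => powCfg (some (.restore j)) s 0 k n₃ (n₄ + k))
    (fun n k => .of_step_eq (by
      simp [powCfg, powProgram, popBranch, stepAux_pushList, update_stacks, List.replicate_succ,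
        ← add_assoc]))
    (fun k => .of_step_eq (by simp [powCfg, powProgram, popBranch, update_stacks])) N 0
  simpa using this

theorem runsIn_restore :
    RunsIn (powProgram C) (powCfg (some (.restore j)) s 0 N n₃ n₄)
      (powCfg (some (.multiply j)) s N 0 n₃ n₄) (N + 1) := by
  have := RunsIn.loop (M := powProgram C) (t := 1) (t₀ := 1)
    (cfg := fun n k => powCfg (some (.restore j)) s k n n₃ n₄)
    (out := fun k => powCfg (some (.multiply j)) s k 0 n₃ n₄)
    (fun n k => .of_step_eq (by
      simp [powCfg, powProgram, popBranch, stepAux_pushList, update_stacks, List.replicate_succ]))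
    (fun k => .of_step_eq (by simp [powCfg, powProgram, popBranch, update_stacks])) N 0
  simpa using this

theorem runsIn_move :
    RunsIn (powProgram C) (powCfg (some (.move j)) s n₁ n₂ 0 N)
      (powCfg (some (.test j.castSucc)) s n₁ n₂ N 0) (N + 1) := by
  have := RunsIn.loop (M := powProgram C) (t := 1) (t₀ := 1)
    (cfg := fun n k => powCfg (some (.move j)) s n₁ n₂ k n)
    (out := fun k => powCfg (some (.test j.castSucc)) s n₁ n₂ k 0)
    (fun n k => .of_step_eq (by
      simp [powCfg, powProgram, popBranch, stepAux_pushList, update_stacks, List.replicate_succ]))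
    (fun k => .of_step_eq (by simp [powCfg, powProgram, popBranch, update_stacks])) N 0
  simpa using this

theorem runsIn_multiply (a : ℕ) :
    RunsIn (powProgram C) (powCfg (some (.multiply j)) s N 0 a 0)
      (powCfg (some (.move j)) s N 0 0 (a * N)) (a * (2 * N + 3) + 1) := by
  have := RunsIn.loop (M := powProgram C) (t := 2 * N + 3) (t₀ := 1)
    (cfg := fun n k => powCfg (some (.multiply j)) s N 0 n (k * N))
    (out := fun k => powCfg (some (.move j)) s N 0 0 (k * N))
    (fun n k => by
      have pop_unit : RunsIn (powProgram C) (powCfg (some (.multiply j)) s N 0 (n + 1) (k * N))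
          (powCfg (some (.copy j)) s N 0 n (k * N)) 1 := .of_step_eq (by
        simp [powCfg, powProgram, popBranch, update_stacks, List.replicate_succ])
      convert (pop_unit.trans (runsIn_copy ..)).trans (runsIn_restore ..) using 1
      · rw [Nat.succ_mul]
      · ring)
    (fun k => .of_step_eq (by simp [powCfg, powProgram, popBranch, update_stacks])) a 0
  simpa using this

theorem runsIn_power (i : Fin (C + 1)) (a : ℕ) :
    RunsIn (powProgram C) (powCfg (some (.test i)) s N 0 a 0)
      (powCfg (some .clear) s N 0 (a * N ^ (i : ℕ)) 0)
      (∑ j ∈ Finset.range i, (a * N ^ j * (3 * N + 3) + 3) + 1) := by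
  induction i using Fin.induction generalizing a with
  | zero => exact .of_step_eq (by simp [powCfg, powProgram])
  | succ j ih =>
    have enter : RunsIn (powProgram C) (powCfg (some (.test j.succ)) s N 0 a 0)
        (powCfg (some (.multiply j)) s N 0 a 0) 1 :=
      .of_step_eq (by simp [powCfg, powProgram])
    convert ((enter.trans (runsIn_multiply ..)).trans (runsIn_move ..)).trans (ih (a * N)) using 1
    · rw [Fin.val_succ, Fin.val_castSucc, pow_succ', mul_assoc]
    · rw [Fin.val_succ, Fin.val_castSucc, Finset.sum_range_succ']
      simp only [pow_succ', pow_zero, mul_one, ← mul_assoc]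
      ring

theorem runsIn_clear :
    RunsIn (powProgram C) (powCfg (some .clear) s N n₂ n₃ n₄)
      (powCfg (some .write) (digit true ++ comma ++ s) 0 n₂ n₃ n₄) (N + 1) := by
  have := RunsIn.loop (M := powProgram C) (t := 1) (t₀ := 1)
    (cfg := fun n _ => powCfg (some .clear) s n n₂ n₃ n₄)
    (out := fun _ => powCfg (some .write) (digit true ++ comma ++ s) 0 n₂ n₃ n₄)
    (fun n _ => .of_step_eq (by
      simp [powCfg, powProgram, popBranch, update_stacks, List.replicate_succ]))
    (fun _ => .of_step_eq (by
      simp [powCfg, powProgram, popBranch, stepAux_pushList, update_stacks])) N 0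
  simpa using this

theorem runsIn_write :
    RunsIn (powProgram C) (powCfg (some .write) s n₁ n₂ N n₄)
      (powCfg none (encodeInt 1 ++ digit false ++ (List.replicate N false).flatMap digit ++ s)
        n₁ n₂ 0 n₄) (N + 1) := by
  have := RunsIn.loop (M := powProgram C) (t := 1) (t₀ := 1)
    (cfg := fun n k =>
      powCfg (some .write) ((List.replicate k false).flatMap digit ++ s) n₁ n₂ n n₄)
    (out := fun k => powCfg none
      (encodeInt 1 ++ digit false ++ (List.replicate k false).flatMap digit ++ s) n₁ n₂ 0 n₄)
    (fun n k => .of_step_eq (by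
      simp [powCfg, powProgram, popBranch, stepAux_pushList, update_stacks, List.replicate_succ]))
    (fun k => .of_step_eq (by
      simp [powCfg, powProgram, popBranch, stepAux_pushList, update_stacks])) N 0
  simpa using this

theorem encodeNat_two_pow (T : ℕ) :
    Computability.encodeNat (2 ^ T) = List.replicate T false ++ [true] := by
  have encodePosNum_bit0 (T : ℕ) : Computability.encodePosNum (PosNum.bit0^[T] 1) =
      List.replicate T false ++ [true] := by
    induction T with
    | zero => rfl
    | succ T ih =>
      rw [Function.iterate_succ_apply', Computability.encodePosNum, ih]
      rfl
  have cast_bit0 (T : ℕ) : ((PosNum.bit0^[T] 1 : PosNum) : ℕ) = 2 ^ T := by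
    induction T with
    | zero => rfl
    | succ T ih => rw [Function.iterate_succ_apply', PosNum.cast_bit0, ih, pow_succ, mul_two]
  have cast_two_pow : ((2 ^ T : ℕ) : Num) = Num.pos (PosNum.bit0^[T] 1) := by
    rw [← cast_bit0 T]
    exact Num.of_to_nat (Num.pos _)
  rw [Computability.encodeNat, cast_two_pow, Computability.encodeNum, encodePosNum_bit0]

theorem encodeRat_one_div_two_pow (T : ℕ) :
    encodeRat (1 / 2 ^ T) = encodeInt 1 ++ digit false ++
      (List.replicate T false).flatMap digit ++ (digit true ++ comma) := by
  have num_eq : ((1 / 2 ^ T : ℚ)).num = 1 := by simp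
  have den_eq : ((1 / 2 ^ T : ℚ)).den = 2 ^ T := by simp
  have not_neg : ¬ ((2 ^ T : ℕ) : ℤ) < 0 := (Int.natCast_nonneg _).not_gt
  have encode_den : encodeInt ((2 ^ T : ℕ) : ℤ) =
      digit false ++ (List.replicate T false ++ [true]).flatMap digit ++ comma := by
    rw [encodeInt, decide_eq_false not_neg, Int.natAbs_natCast, encodeNat_two_pow]
  rw [encodeRat, num_eq, den_eq, encode_den]
  simp

/-- The running time of `powMachine C`. -/
noncomputable def powTime (C : ℕ) : Polynomial ℕ :=
  (∑ i ∈ Finset.range C, (Polynomial.X ^ i * (3 * Polynomial.X + 3) + 3)) + 2 * Polynomial.X +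
    Polynomial.X ^ C + 4

theorem runsIn_powMachine (C : ℕ) (s : List Bool) :
    RunsIn (powProgram C) (powCfg (some .read) s 0 0 0 0)
      (powCfg none (encodeRat (1 / 2 ^ (s.length ^ C))) 0 0 0 0)
      ((powTime C).eval s.length) := by
  convert (((runsIn_read s 0 0 0).trans (runsIn_power ..)).trans
    (runsIn_clear ..)).trans (runsIn_write ..) using 1
  · rw [encodeRat_one_div_two_pow]
    simp
  · simp [powTime, Polynomial.eval_finsetSum]
    ring

theorem initList_powMachine (C : ℕ) (s : List Bool) :
    initList (powMachine C) (s.map (Equiv.refl Bool).invFun) = powCfg (some .read) s 0 0 0 0 :=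
  congrArg (TM2.Cfg.mk _ _) <| funext fun k : Fin 5 => by
    fin_cases k
    exacts [List.map_id s, rfl, rfl, rfl, rfl]

theorem haltList_powMachine (C : ℕ) (s : List Bool) :
    haltList (powMachine C) (s.map (Equiv.refl Bool).invFun) = powCfg none s 0 0 0 0 :=
  congrArg (TM2.Cfg.mk _ _) <| funext fun k : Fin 5 => by
    fin_cases k
    exacts [List.map_id s, rfl, rfl, rfl, rfl]

theorem tm2ComputableInPolyTime_one_div_two_pow {α : Type} (ea : α → List Bool) (C : ℕ) :
    Nonempty (TM2ComputableInPolyTime ea encodeRat fun x => 1 / 2 ^ ((ea x).length ^ C)) :=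
  ⟨{ tm := powMachine C
     inputAlphabet := .refl Bool
     outputAlphabet := .refl Bool
     time := powTime C
     outputsFun := fun x => by
      have run := (runsIn_powMachine C (ea x)).some
      rw [← initList_powMachine, ← haltList_powMachine] at run
      exact run }⟩

end Machine

section Liouville

open Polynomial NumberField

theorem norm_leadingCoeff_mul_le {𝕜 : Type*} [NormedField 𝕜] {p : 𝕜[X]} (hp : p ≠ 0) {a : 𝕜}
    (ha : p.IsRoot a) {H : ℝ} (hH : ∀ i, ‖p.coeff i‖ ≤ H) : ‖p.leadingCoeff * a‖ ≤ 2 * H := by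
  have lc_pos : 0 < ‖p.leadingCoeff‖ := norm_pos_iff.2 (leadingCoeff_ne_zero.2 hp)
  have sup_le : ((Finset.range p.natDegree).sup fun i => ‖p.coeff i‖₊ : NNReal) ≤ H := by
    lift H to NNReal using (norm_nonneg _).trans (hH 0)
    exact NNReal.coe_le_coe.2 (Finset.sup_le fun i _ => NNReal.coe_le_coe.1 (hH i))
  have root_bound : ‖a‖ ≤ p.cauchyBound := NNReal.coe_le_coe.2 (ha.norm_lt_cauchyBound hp).le
  calc ‖p.leadingCoeff * a‖ ≤ ‖p.leadingCoeff‖ * p.cauchyBound := by rw [norm_mul]; gcongr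
    _ = ((Finset.range p.natDegree).sup fun i => ‖p.coeff i‖₊ : NNReal) + ‖p.leadingCoeff‖ := by
      rw [cauchyBound, NNReal.coe_add, NNReal.coe_div, coe_nnnorm, NNReal.coe_one, mul_add,
        mul_div_cancel₀ _ lc_pos.ne', mul_one]
    _ ≤ H + H := add_le_add sup_le (hH _)
    _ = 2 * H := (two_mul H).symm

theorem norm_le_of_mem_rootSet {p : ℤ[X]} {N : ℕ} (hp : ∀ i, |p.coeff i| ≤ 2 ^ N) {z : ℂ}
    (hz : z ∈ p.rootSet ℂ) : ‖z‖ ≤ 2 ^ (N + 1) := by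
  obtain ⟨hp0, hz⟩ := mem_rootSet.1 hz
  have hinj : Function.Injective (Int.castRingHom ℂ) := Int.cast_injective
  have coeff_le (i : ℕ) : ‖(p.map (Int.castRingHom ℂ)).coeff i‖ ≤ 2 ^ N := by
    rw [coeff_map, eq_intCast, Complex.norm_intCast]
    exact_mod_cast hp i
  have one_le_lc : (1 : ℝ) ≤ ‖(p.leadingCoeff : ℂ)‖ := by
    rw [Complex.norm_intCast]
    exact_mod_cast Int.one_le_abs (leadingCoeff_ne_zero.2 hp0)
  have := norm_leadingCoeff_mul_le ((Polynomial.map_ne_zero_iff hinj).2 hp0)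
    (by rwa [IsRoot, eval_map, ← algebraMap_int_eq, ← aeval_def]) coeff_le
  rw [leadingCoeff_map_of_injective hinj, eq_intCast, norm_mul] at this
  calc ‖z‖ ≤ ‖(p.leadingCoeff : ℂ)‖ * ‖z‖ := le_mul_of_one_le_left (norm_nonneg z) one_le_lc
    _ ≤ 2 ^ (N + 1) := this.trans_eq (pow_succ' 2 N).symm

theorem algebraMap_pow_mul_aeval {R A : Type*} [CommRing R] [CommRing A] [Algebra R A] {Q : R[X]}
    {n : ℕ} (hQ : Q.natDegree ≤ n) (a : R) (z : A) :
    algebraMap R A a ^ n * aeval z Q = ∑ i ∈ Finset.range (n + 1),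
      algebraMap R A (Q.coeff i) * algebraMap R A a ^ (n - i) * (algebraMap R A a * z) ^ i := by
  rw [aeval_eq_sum_range' (Nat.lt_succ_of_le hQ), Finset.mul_sum]
  refine Finset.sum_congr rfl fun i hi => ?_
  rw [← pow_sub_mul_pow _ (Nat.lt_succ_iff.1 (Finset.mem_range.1 hi)), Algebra.smul_def]
  ring

theorem isIntegral_leadingCoeff_pow_mul_aeval {K : Type*} [Field K] {P Q : (𝓞 K)[X]}
    {z : K} {n : ℕ} (hz : aeval z P = 0) (hQn : Q.natDegree ≤ n) :
    IsIntegral ℤ ((P.leadingCoeff : K) ^ n * aeval z Q) := by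
  have isIntegral_lc_mul : IsIntegral ℤ ((P.leadingCoeff : K) * z) := by
    rw [← Algebra.smul_def]
    exact isIntegral_trans _ (isIntegral_leadingCoeff_smul P z hz)
  rw [algebraMap_pow_mul_aeval hQn]
  exact .sum _ fun i _ => ((RingOfIntegers.isIntegral_coe _).mul
    ((RingOfIntegers.isIntegral_coe _).pow _)).mul (isIntegral_lc_mul.pow i)

theorem isIntegral_prod_leadingCoeff_mul {ι A : Type*} [Fintype ι] [CommRing A] {p : ι → ℤ[X]}
    {i : ι} {x : A} (hx : aeval x (p i) = 0) :
    IsIntegral ℤ (((∏ j, (p j).leadingCoeff : ℤ) : A) * x) := by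
  obtain ⟨c, hc⟩ := Finset.dvd_prod_of_mem (fun j => (p j).leadingCoeff) (Finset.mem_univ i)
  have := (isIntegral_algebraMap (R := ℤ) (A := A) (x := c)).mul
    (isIntegral_leadingCoeff_smul (p i) x hx)
  rw [zsmul_eq_mul] at this
  rwa [hc, Int.cast_mul, mul_right_comm, mul_comm _ (c : A)]

theorem abs_prod_leadingCoeff_le {ι : Type*} [Fintype ι] {p : ι → ℤ[X]} {N : ℕ}
    (hp : ∀ i j, |(p i).coeff j| ≤ 2 ^ N) :
    |∏ i, (p i).leadingCoeff| ≤ 2 ^ (N * Fintype.card ι) := by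
  rw [Finset.abs_prod, pow_mul]
  exact (Finset.prod_le_prod (fun _ _ => abs_nonneg _) fun i _ => hp i _).trans_eq (by simp)

variable {K : Type*} [Field K] [NumberField K]

theorem house_le {x : K} {M : ℝ} (h : ∀ σ : K →+* ℂ, ‖σ x‖ ≤ M) : house x ≤ M := by
  rw [house_eq_sup']
  lift M to NNReal using (norm_nonneg _).trans (h (Classical.arbitrary _))
  exact NNReal.coe_le_coe.2 (Finset.sup'_le _ _ fun σ _ => NNReal.coe_le_coe.1 (h σ))

theorem house_mul_pow_mul_pow_le {x y w : K} {M : ℝ} (hx : house x ≤ M) (hy : house y ≤ M)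
    (hw : house w ≤ M) (i j : ℕ) : house (x * y ^ i * w ^ j) ≤ M ^ (i + j + 1) :=
  house_le fun σ => by
    have M_nonneg : 0 ≤ M := (house_nonneg x).trans hx
    have norm_le {u : K} (hu : house u ≤ M) : ‖σ u‖ ≤ M := (norm_embedding_le_house u σ).trans hu
    calc ‖σ (x * y ^ i * w ^ j)‖ = ‖σ x‖ * ‖σ y‖ ^ i * ‖σ w‖ ^ j := by
          simp only [map_mul, map_pow, norm_mul, norm_pow]
      _ ≤ M * M ^ i * M ^ j := by gcongr <;> apply norm_le <;> assumption
      _ = M ^ (i + j + 1) := by ring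

theorem house_le_of_mem_rootSet {p : ℤ[X]} {N : ℕ} (hp : ∀ i, |p.coeff i| ≤ 2 ^ N) {x : K}
    (hx : x ∈ p.rootSet K) : house x ≤ 2 ^ (N + 1) :=
  house_le fun σ => norm_le_of_mem_rootSet hp <| by
    obtain ⟨hp0, hx⟩ := mem_rootSet.1 hx
    refine mem_rootSet.2 ⟨hp0, ?_⟩
    rw [← σ.toIntAlgHom_apply, aeval_algHom_apply, hx, map_zero]

theorem one_le_norm_mul_house_pow {x : K} (hx : IsIntegral ℤ x) (hx0 : x ≠ 0) (τ : K →+* ℂ) :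
    1 ≤ ‖τ x‖ * house x ^ (Module.finrank ℚ K - 1) := by
  refine le_trans ?_ (norm_norm_le_norm_mul_house_pow x τ)
  obtain ⟨m, hm⟩ := IsIntegrallyClosed.isIntegral_iff.1 (Algebra.isIntegral_norm ℚ hx)
  have hm0 : m ≠ 0 := by
    rintro rfl
    exact hx0 (Algebra.norm_eq_zero_iff.1 (by rw [← hm, map_zero]))
  rw [← hm, eq_intCast, ← Rat.norm_cast_real, Rat.cast_intCast, Int.norm_cast_real, Int.norm_eq_abs]
  exact_mod_cast Int.one_le_abs hm0

theorem house_leadingCoeff_mul_le {P : (𝓞 K)[X]} (hP : P ≠ 0) {z : K} (hz : aeval z P = 0) {H : ℝ}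
    (hH : ∀ i, house (P.coeff i : K) ≤ H) : house ((P.leadingCoeff : K) * z) ≤ 2 * H :=
  house_le fun σ => by
    have hinj : Function.Injective (σ.comp (algebraMap (𝓞 K) K)) :=
      σ.injective.comp RingOfIntegers.coe_injective
    have := norm_leadingCoeff_mul_le ((Polynomial.map_ne_zero_iff hinj).2 hP) (a := σ z)
      (by rw [IsRoot, eval_map, ← hom_eval₂, ← aeval_def, hz, map_zero])
      (fun i => by rw [coeff_map]; exact (norm_embedding_le_house _ σ).trans (hH i))
    rwa [leadingCoeff_map_of_injective hinj, RingHom.comp_apply, ← map_mul] at this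

section Values

variable {P Q : (𝓞 K)[X]} {z : K} {n : ℕ} {H : ℝ}

theorem house_leadingCoeff_pow_mul_aeval_le (hP : P ≠ 0) (hz : aeval z P = 0)
    (hQn : Q.natDegree ≤ n) (hPH : ∀ i, house (P.coeff i : K) ≤ H)
    (hQH : ∀ i, house (Q.coeff i : K) ≤ H) :
    house ((P.leadingCoeff : K) ^ n * aeval z Q) ≤ (n + 1) * (2 * H) ^ (n + 1) := by
  have le_two_mul {x : K} (hx : house x ≤ H) : house x ≤ 2 * H := by
    linarith [house_nonneg x]
  rw [algebraMap_pow_mul_aeval hQn]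
  refine (house_sum_le_sum_house _ _).trans ((Finset.sum_le_card_nsmul _ _ ((2 * H) ^ (n + 1))
    fun i hi => ?_).trans_eq (by simp))
  refine (house_mul_pow_mul_pow_le (le_two_mul (hQH i)) (le_two_mul (hPH P.natDegree))
    (house_leadingCoeff_mul_le hP hz hPH) (n - i) i).trans_eq ?_
  rw [Nat.sub_add_cancel (Nat.lt_succ_iff.1 (Finset.mem_range.1 hi))]

theorem one_le_norm_aeval_mul_pow (hP : P ≠ 0) (hz : aeval z P = 0) (hQn : Q.natDegree ≤ n)
    (hPH : ∀ i, house (P.coeff i : K) ≤ H) (hQH : ∀ i, house (Q.coeff i : K) ≤ H)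
    (hQz : aeval z Q ≠ 0) (τ : K →+* ℂ) :
    1 ≤ ‖τ (aeval z Q)‖ * ((n + 1) * (2 * H) ^ (n + 1)) ^ Module.finrank ℚ K := by
  set a := (P.leadingCoeff : K)
  set B : ℝ := (n + 1) * (2 * H) ^ (n + 1)
  have ha0 : a ≠ 0 := RingOfIntegers.coe_ne_zero_iff.2 (leadingCoeff_ne_zero.2 hP)
  have one_le_H : 1 ≤ H :=
    (one_le_house_of_isIntegral (RingOfIntegers.isIntegral_coe _) ha0).trans (hPH _)
  have norm_pow_le : ‖τ a‖ ^ n ≤ B :=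
    calc ‖τ a‖ ^ n ≤ (2 * H) ^ n := by
          gcongr
          exact (norm_embedding_le_house a τ).trans ((hPH _).trans (by linarith))
      _ ≤ (2 * H) ^ (n + 1) := pow_le_pow_right₀ (by linarith) n.le_succ
      _ ≤ B := le_mul_of_one_le_left (by positivity) (by simp)
  have house_le := house_leadingCoeff_pow_mul_aeval_le hP hz hQn hPH hQH
  calc 1 ≤ ‖τ (a ^ n * aeval z Q)‖ * house (a ^ n * aeval z Q) ^ (Module.finrank ℚ K - 1) :=
      one_le_norm_mul_house_pow (isIntegral_leadingCoeff_pow_mul_aeval hz hQn)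
        (mul_ne_zero (pow_ne_zero n ha0) hQz) τ
    _ ≤ (B * ‖τ (aeval z Q)‖) * B ^ (Module.finrank ℚ K - 1) := by
      rw [map_mul, norm_mul, map_pow, norm_pow]
      have := house_nonneg (a ^ n * aeval z Q)
      gcongr
    _ = ‖τ (aeval z Q)‖ * B ^ Module.finrank ℚ K := by
      rw [mul_comm B, mul_assoc, mul_pow_sub_one Module.finrank_pos.ne']

end Values

end Liouville

section Euler

open Polynomial
open scoped ContDiff

/-- The differential operator `z d/dz - k` on polynomials. On the unit circle, differentiating
`z ↦ z⁻ᵏ P(z)` in the angle amounts to applying it to `P`, up to a factor of `I`. -/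
noncomputable def eulerOp {R : Type*} [CommRing R] (k : ℕ) (P : R[X]) : R[X] :=
  X * derivative P - k • P

theorem coeff_iterate_eulerOp {R : Type*} [CommRing R] (k n : ℕ) (P : R[X]) (j : ℕ) :
    ((eulerOp k)^[n] P).coeff j = (j - k : R) ^ n * P.coeff j := by
  induction n with
  | zero => simp
  | succ n ih =>
    rw [Function.iterate_succ_apply', eulerOp, coeff_sub, coeff_smul, nsmul_eq_mul]
    cases j with
    | zero => rw [coeff_X_mul_zero, ih]; push_cast; ring
    | succ j => rw [coeff_X_mul, coeff_derivative, ih]; push_cast; ring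

theorem iterate_eulerOp_C_mul {R : Type*} [CommRing R] (k : ℕ) (a : R) (P : R[X]) (n : ℕ) :
    (eulerOp k)^[n] (C a * P) = C a * (eulerOp k)^[n] P := by
  ext j
  simp only [coeff_iterate_eulerOp, coeff_C_mul]
  ring

theorem map_iterate_eulerOp {R S : Type*} [CommRing R] [CommRing S] (σ : R →+* S) (k n : ℕ)
    (P : R[X]) : ((eulerOp k)^[n] P).map σ = (eulerOp k)^[n] (P.map σ) := by
  ext j
  simp only [coeff_map, coeff_iterate_eulerOp, map_mul, map_pow, map_sub, map_natCast]

theorem natDegree_iterate_eulerOp_le {R : Type*} [CommRing R] {k N : ℕ} {P : R[X]}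
    (hP : P.natDegree ≤ N) (n : ℕ) : ((eulerOp k)^[n] P).natDegree ≤ N :=
  natDegree_le_iff_coeff_eq_zero.2 fun j hj => by
    rw [coeff_iterate_eulerOp, coeff_eq_zero_of_natDegree_lt (hP.trans_lt hj), mul_zero]

theorem exists_le_eval_iterate_eulerOp_ne_zero {F : Type*} [Field F] [CharZero F] {P : F[X]}
    (hP : P ≠ 0) {N : ℕ} (hN : P.natDegree ≤ N) (k : ℕ) {w : F} (hw : w ≠ 0) :
    ∃ n ≤ N, ((eulerOp k)^[n] P).eval w ≠ 0 := by
  by_contra! vanish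
  have injective_sub : Function.Injective fun j : Fin (N + 1) => ((j : ℕ) - k : F) :=
    fun i j h => Fin.ext (Nat.cast_injective (sub_left_injective h))
  have terms_eq_zero := Matrix.eq_zero_of_forall_pow_sum_mul_pow_eq_zero injective_sub
    (v := fun j : Fin (N + 1) => P.coeff j * w ^ (j : ℕ)) fun n => by
      rw [← vanish n (Nat.lt_succ_iff.1 n.is_lt),
        eval_eq_sum_range' (Nat.lt_succ_of_le (natDegree_iterate_eulerOp_le hN n)),
        ← Fin.sum_univ_eq_sum_range]
      exact Finset.sum_congr rfl fun j _ => by rw [coeff_iterate_eulerOp]; ring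
  refine hP (leadingCoeff_eq_zero.1 ((mul_eq_zero.1 ?_).resolve_right (pow_ne_zero P.natDegree hw)))
  exact congrFun terms_eq_zero ⟨P.natDegree, Nat.lt_succ_of_le hN⟩

theorem norm_coeff_iterate_eulerOp_le {P : ℂ[X]} {k : ℕ} (hP : P.natDegree ≤ 2 * k) {B : ℝ}
    (hB : ∀ j, ‖P.coeff j‖ ≤ B) (n j : ℕ) : ‖((eulerOp k)^[n] P).coeff j‖ ≤ k ^ n * B := by
  have B_nonneg : 0 ≤ B := (norm_nonneg _).trans (hB 0)
  rcases lt_or_ge (2 * k) j with hj | hj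
  · rw [coeff_eq_zero_of_natDegree_lt ((natDegree_iterate_eulerOp_le hP n).trans_lt hj), norm_zero]
    positivity
  · have norm_sub_le : ‖(j - k : ℂ)‖ ≤ k := by
      rw [← Int.cast_natCast j, ← Int.cast_natCast k, ← Int.cast_sub, Complex.norm_intCast]
      exact_mod_cast abs_le.2 ⟨by lia, by lia⟩
    rw [coeff_iterate_eulerOp, norm_mul, norm_pow]
    gcongr
    exact hB j

theorem norm_eval_iterate_eulerOp_le {P : ℂ[X]} {k : ℕ} (hP : P.natDegree ≤ 2 * k) {B : ℝ}
    (hB : ∀ j, ‖P.coeff j‖ ≤ B) (n : ℕ) {w : ℂ} (hw : ‖w‖ = 1) :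
    ‖((eulerOp k)^[n] P).eval w‖ ≤ (2 * k + 1) * (k ^ n * B) := by
  rw [eval_eq_sum_range' (Nat.lt_succ_of_le (natDegree_iterate_eulerOp_le hP n))]
  refine (norm_sum_le_of_le (f := _) _ fun j _ => ?_).trans_eq
    ((Finset.sum_const (k ^ n * B)).trans (by simp))
  simpa only [norm_mul, norm_pow, hw, one_pow, mul_one] using
    norm_coeff_iterate_eulerOp_le hP hB n j

open Complex in
theorem hasDerivAt_exp_mul_I_pow (k : ℕ) (x : ℝ) :
    HasDerivAt (fun y : ℝ => exp (y * I) ^ k) (k * exp (x * I) ^ k * I) x := by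
  simp only [← exp_nat_mul, mul_left_comm (k : ℂ), mul_right_comm _ _ I]
  exact ((hasDerivAt_mul_const (k * I)).comp_ofReal.cexp).congr_deriv (by ring)

open Complex in
theorem exp_pow_mul_iteratedDeriv {g : ℝ → ℝ} (hg : ContDiff ℝ ∞ g) {k : ℕ} {P : ℂ[X]}
    (hP : ∀ x : ℝ, exp (x * I) ^ k * g x = P.eval (exp (x * I))) (n : ℕ) (x : ℝ) :
    exp (x * I) ^ k * iteratedDeriv n g x = I ^ n * ((eulerOp k)^[n] P).eval (exp (x * I)) := by
  induction n generalizing x with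
  | zero => simpa using hP x
  | succ n ih =>
    have deriv_exp : HasDerivAt (fun y : ℝ => exp (y * I)) (exp (x * I) * I) x := by
      simpa using hasDerivAt_exp_mul_I_pow 1 x
    have deriv_g : HasDerivAt (fun y => ((iteratedDeriv n g y : ℝ) : ℂ))
        (iteratedDeriv (n + 1) g x : ℝ) x := by
      rw [iteratedDeriv_succ]
      exact (hg.differentiable_iteratedDeriv n
        (by exact_mod_cast WithTop.coe_lt_top n)).differentiableAt.hasDerivAt.ofReal_comp
    have deriv_lhs := (hasDerivAt_exp_mul_I_pow k x).mul deriv_g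
    have deriv_rhs := ((((eulerOp k)^[n] P).hasDerivAt _).comp x deriv_exp).const_mul (I ^ n)
    have deriv_eq := deriv_lhs.unique
      (deriv_rhs.congr_of_eventuallyEq (Filter.Eventually.of_forall ih))
    rw [Function.iterate_succ_apply', eulerOp, eval_sub, eval_mul, eval_X, nsmul_eq_mul, eval_mul,
      eval_natCast]
    linear_combination deriv_eq - k * I * ih x

theorem abs_iteratedDeriv_eq_norm_eval {g : ℝ → ℝ} (hg : ContDiff ℝ ∞ g) {k : ℕ} {P : ℂ[X]}
    (hP : ∀ x : ℝ, Complex.exp (x * Complex.I) ^ k * g x = P.eval (Complex.exp (x * Complex.I)))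
    (n : ℕ) (x : ℝ) :
    |iteratedDeriv n g x| = ‖((eulerOp k)^[n] P).eval (Complex.exp (x * Complex.I))‖ := by
  simpa using congrArg norm (exp_pow_mul_iteratedDeriv hg hP n x)

end Euler

section CirclePolynomial

open Polynomial ComplexConjugate
open scoped ContDiff

/-- The polynomial `∑ m, (bₘ zᵏ⁺ᵐ + cₘ zᵏ⁻ᵐ)`, that is, `zᵏ` times the Laurent polynomial with
coefficients `bₘ` at `zᵐ` and `cₘ` at `z⁻ᵐ`. The dominant function with coefficients `β` is given
on the unit circle by `b = β` and `c = conj β`. -/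
noncomputable def circlePoly {R : Type*} [CommRing R] {k : ℕ} (b c : Fin (k + 1) → R) : R[X] :=
  ∑ m, (C (b m) * X ^ (k + (m : ℕ)) + C (c m) * X ^ (k - (m : ℕ)))

variable {R : Type*} [CommRing R] {k : ℕ}

theorem circlePoly_mul (a : R) (b c : Fin (k + 1) → R) :
    circlePoly (fun m => a * b m) (fun m => a * c m) = C a * circlePoly b c := by
  simp only [circlePoly, map_mul, Finset.mul_sum, mul_add, mul_assoc]

theorem map_circlePoly {S : Type*} [CommRing S] (σ : R →+* S) (b c : Fin (k + 1) → R) :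
    (circlePoly b c).map σ = circlePoly (σ ∘ b) (σ ∘ c) := by
  simp [circlePoly, Polynomial.map_sum]

theorem natDegree_circlePoly_le (b c : Fin (k + 1) → R) : (circlePoly b c).natDegree ≤ 2 * k :=
  natDegree_sum_le_of_forall_le _ _ fun m _ =>
    natDegree_add_le_of_degree_le ((natDegree_C_mul_X_pow_le _ _).trans (by lia))
      ((natDegree_C_mul_X_pow_le _ _).trans (by lia))

theorem coeff_circlePoly (b c : Fin (k + 1) → R) (j : ℕ) :
    (circlePoly b c).coeff j =
      ∑ m : Fin (k + 1), ((if j = k + m then b m else 0) + if j = k - m then c m else 0) := by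
  simp only [circlePoly, finsetSum_coeff, coeff_add, coeff_C_mul_X_pow]

theorem circlePoly_ne_zero {b : Fin (k + 1) → R} (c : Fin (k + 1) → R) {m : Fin (k + 1)}
    (hm : 1 ≤ (m : ℕ)) (hb : b m ≠ 0) : circlePoly b c ≠ 0 := fun h => hb <| by
  have coeff_eq : (circlePoly b c).coeff (k + m) = b m := by
    rw [coeff_circlePoly, Finset.sum_eq_single m]
    · simp only [if_true, if_neg (show k + (m : ℕ) ≠ k - m by lia), add_zero]
    · intro l _ hl
      rw [if_neg (fun h => hl (Fin.ext (by lia))), if_neg (by lia), add_zero]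
    · simp
  rw [← coeff_eq, h, coeff_zero]

theorem norm_coeff_circlePoly_le {b c : Fin (k + 1) → ℂ} {B : ℝ} (hb : ∀ m, ‖b m‖ ≤ B)
    (hc : ∀ m, ‖c m‖ ≤ B) (j : ℕ) : ‖(circlePoly b c).coeff j‖ ≤ 2 * (k + 1) * B := by
  have B_nonneg : 0 ≤ B := (norm_nonneg _).trans (hb 0)
  rw [coeff_circlePoly]
  refine (norm_sum_le_of_le (f := _) _ fun m _ => norm_add_le_of_le (r₁ := B)
    (r₂ := B) ?_ ?_).trans_eq ((Finset.sum_const (B + B)).trans ?_)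
  · split_ifs
    exacts [hb m, norm_zero.trans_le B_nonneg]
  · split_ifs
    exacts [hc m, norm_zero.trans_le B_nonneg]
  · rw [Finset.card_univ, Fintype.card_fin, nsmul_eq_mul]
    push_cast
    ring

theorem circlePoly_eval_of_norm_eq_one (β : Fin (k + 1) → ℂ) {z : ℂ} (hz : ‖z‖ = 1) :
    (circlePoly β (conj ∘ β)).eval z = z ^ k * dominant β z := by
  have mul_conj : z * conj z = 1 := by rw [Complex.mul_conj', hz, Complex.ofReal_one, one_pow]
  rw [coe_dominant, circlePoly, eval_finsetSum, Finset.mul_sum]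
  refine Finset.sum_congr rfl fun m _ => ?_
  have pow_eq : z ^ k * conj z ^ (m : ℕ) = z ^ (k - (m : ℕ)) := by
    rw [← pow_sub_mul_pow z (Nat.lt_succ_iff.1 m.is_lt), mul_assoc, ← mul_pow, mul_conj, one_pow,
      mul_one]
  simp only [eval_add, eval_mul, eval_C, eval_pow, eval_X, Function.comp_apply, ← pow_eq, pow_add]
  ring

theorem contDiff_circleFun (β : Fin (k + 1) → ℂ) : ContDiff ℝ ∞ (circleFun β) := by
  have : ContDiff ℝ ∞ fun x : ℝ => Complex.exp (x * Complex.I) :=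
    (Complex.ofRealCLM.contDiff.mul contDiff_const).cexp
  exact Complex.reCLM.contDiff.comp <| ContDiff.sum fun m _ =>
    (contDiff_const.mul (this.pow m)).add
      (contDiff_const.mul ((Complex.conjCLE.contDiff.comp this).pow m))

theorem abs_iteratedDeriv_circleFun (β : Fin (k + 1) → ℂ) (n : ℕ) (x : ℝ) :
    |iteratedDeriv n (circleFun β) x| =
      ‖((eulerOp k)^[n] (circlePoly β (conj ∘ β))).eval (Complex.exp (x * Complex.I))‖ :=
  abs_iteratedDeriv_eq_norm_eval (contDiff_circleFun β)
    (fun y => (circlePoly_eval_of_norm_eq_one β (Complex.norm_exp_ofReal_mul_I y)).symm) n x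

theorem exists_le_iteratedDeriv_circleFun_ne_zero {β : Fin (k + 1) → ℂ} {m : Fin (k + 1)}
    (hm : 1 ≤ (m : ℕ)) (hβ : β m ≠ 0) (x : ℝ) :
    ∃ n ≤ 2 * k, iteratedDeriv n (circleFun β) x ≠ 0 := by
  obtain ⟨n, hn, eval_ne⟩ := exists_le_eval_iterate_eulerOp_ne_zero
    (circlePoly_ne_zero (conj ∘ β) hm hβ) (natDegree_circlePoly_le _ _) k
    (Complex.exp_ne_zero (x * Complex.I))
  exact ⟨n, hn, abs_pos.1 (abs_iteratedDeriv_circleFun β n x ▸ norm_pos_iff.2 eval_ne)⟩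

theorem abs_iteratedDeriv_circleFun_le {β : Fin (k + 1) → ℂ} {B : ℝ} (hB : ∀ m, ‖β m‖ ≤ B)
    (n : ℕ) (x : ℝ) :
    |iteratedDeriv n (circleFun β) x| ≤ (2 * k + 1) * (k ^ n * (2 * (k + 1) * B)) := by
  rw [abs_iteratedDeriv_circleFun]
  exact norm_eval_iterate_eulerOp_le (natDegree_circlePoly_le _ _)
    (norm_coeff_circlePoly_le hB fun m => (RCLike.norm_conj (β m)).trans_le (hB m)) n
    (Complex.norm_exp_ofReal_mul_I x)

end CirclePolynomial

section Taylor

open scoped ContDiff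

variable {g : ℝ → ℝ} {φ : ℝ}

theorem iteratedDeriv_firstOrder_ne_zero {n : ℕ} (hn : iteratedDeriv n g φ ≠ 0) :
    iteratedDeriv (firstOrder g φ) g φ ≠ 0 :=
  Nat.sInf_mem (s := {d | iteratedDeriv d g φ ≠ 0}) ⟨n, hn⟩

theorem iteratedDeriv_eq_zero_of_lt_firstOrder {n : ℕ} (hn : n < firstOrder g φ) :
    iteratedDeriv n g φ = 0 :=
  not_not.1 (Nat.notMem_of_lt_sInf hn)

theorem firstOrder_pos {n : ℕ} (hn : iteratedDeriv n g φ ≠ 0) (hφ : g φ = 0) :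
    0 < firstOrder g φ :=
  Nat.pos_of_ne_zero fun h => iteratedDeriv_firstOrder_ne_zero hn (by rwa [h, iteratedDeriv_zero])

theorem firstOrder_deriv_add_one (h : 0 < firstOrder g φ) :
    firstOrder (deriv g) φ + 1 = firstOrder g φ := by
  simpa only [firstOrder, iteratedDeriv_succ'] using Nat.sInf_add (n := 1) h

theorem deriv_firstTaylor (h : 0 < firstOrder g φ) :
    deriv (firstTaylor g φ) = firstTaylor (deriv g) φ := by
  funext x
  have : HasDerivAt (fun y => (y - φ) ^ (firstOrder (deriv g) φ + 1))
      ((firstOrder (deriv g) φ + 1 : ℕ) * (x - φ) ^ firstOrder (deriv g) φ) x := by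
    simpa using! ((hasDerivAt_id x).sub_const φ).fun_pow (firstOrder (deriv g) φ + 1)
  unfold firstTaylor
  rw [← firstOrder_deriv_add_one h, (this.const_mul _).deriv, iteratedDeriv_succ',
    Nat.factorial_succ]
  push_cast
  field_simp

theorem firstTaylor_self : firstTaylor g φ φ = g φ := by
  rcases (firstOrder g φ).eq_zero_or_pos with h | h
  · simp [firstTaylor, h]
  · rw [firstTaylor, sub_self, zero_pow h.ne', mul_zero,
      ← iteratedDeriv_eq_zero_of_lt_firstOrder h, iteratedDeriv_zero]

theorem taylorWithinEval_firstOrder (hg : ContDiff ℝ ∞ g) {s : Set ℝ} (hs : UniqueDiffOn ℝ s)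
    (hφ : φ ∈ s) (x : ℝ) : taylorWithinEval g (firstOrder g φ) s φ x = firstTaylor g φ x := by
  have iteratedDerivWithin_eq (n : ℕ) : iteratedDerivWithin n g s φ = iteratedDeriv n g φ :=
    iteratedDerivWithin_eq_iteratedDeriv hs (hg.of_le (by exact_mod_cast le_top)).contDiffAt hφ
  rw [taylor_within_apply, Finset.sum_range_succ, Finset.sum_eq_zero fun n hn => ?_, zero_add,
    iteratedDerivWithin_eq, smul_eq_mul, firstTaylor]
  · ring
  · rw [iteratedDerivWithin_eq, iteratedDeriv_eq_zero_of_lt_firstOrder (Finset.mem_range.1 hn),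
      smul_zero]

theorem abs_sub_firstTaylor_le (hg : ContDiff ℝ ∞ g) {M : ℝ}
    (hM : ∀ x, |iteratedDeriv (firstOrder g φ + 1) g x| ≤ M) (x : ℝ) :
    |g x - firstTaylor g φ x| ≤
      M * |x - φ| ^ (firstOrder g φ + 1) / (firstOrder g φ + 1).factorial := by
  rcases eq_or_ne φ x with rfl | hx
  · simp [firstTaylor_self]
  · obtain ⟨y, -, hy⟩ := taylor_mean_remainder_lagrange_iteratedDeriv (n := firstOrder g φ) hx
      (hg.of_le (by exact_mod_cast le_top)).contDiffOn
    rw [taylorWithinEval_firstOrder hg (uniqueDiffOn_uIcc hx) Set.left_mem_uIcc] at hy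
    rw [hy, abs_div, abs_mul, abs_pow, Nat.abs_cast]
    gcongr
    exact hM y

theorem abs_sub_firstTaylor_le_half (hg : ContDiff ℝ ∞ g) {M ε : ℝ}
    (hM : ∀ x, |iteratedDeriv (firstOrder g φ + 1) g x| ≤ M)
    (hε : 2 * M * ε ≤ |iteratedDeriv (firstOrder g φ) g φ|) {x : ℝ} (hx : |x - φ| ≤ ε) :
    |g x - firstTaylor g φ x| ≤ 1 / 2 * |firstTaylor g φ x| := by
  refine (abs_sub_firstTaylor_le hg hM x).trans ?_
  set d := firstOrder g φ
  have M_nonneg : 0 ≤ M := (abs_nonneg _).trans (hM x)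
  calc M * |x - φ| ^ (d + 1) / (d + 1).factorial
      ≤ M * |x - φ| ^ (d + 1) / d.factorial := by
        gcongr
        exact d.le_succ
    _ = 1 / 2 * ((2 * M * |x - φ|) / d.factorial * |x - φ| ^ d) := by ring
    _ ≤ 1 / 2 * (|iteratedDeriv d g φ| / d.factorial * |x - φ| ^ d) := by
        gcongr
        exact le_trans (by gcongr) hε
    _ = 1 / 2 * |firstTaylor g φ x| := by
        rw [firstTaylor, abs_mul, abs_div, abs_pow, Nat.abs_cast]

theorem sign_eq_of_abs_sub_le_half {a b : ℝ} (h : |a - b| ≤ 1 / 2 * |b|) :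
    SignType.sign a = SignType.sign b := by
  obtain ⟨lower, upper⟩ := abs_le.1 h
  rcases lt_trichotomy b 0 with hb | rfl | hb
  · rw [abs_of_neg hb] at upper
    rw [sign_neg hb, sign_neg (by linarith)]
  · rw [abs_zero] at lower upper
    rw [show a = 0 by linarith]
  · rw [abs_of_pos hb] at lower
    rw [sign_pos hb, sign_pos (by linarith)]

theorem sign_firstTaylor_of_gt {x : ℝ} (hx : φ < x) :
    SignType.sign (firstTaylor g φ x) = SignType.sign (iteratedDeriv (firstOrder g φ) g φ) := by
  rw [firstTaylor, sign_mul, sign_pow, sign_pos (sub_pos.2 hx), one_pow, mul_one, div_eq_mul_inv,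
    sign_mul, sign_pos (inv_pos.2 (by positivity)), mul_one]

theorem sign_firstTaylor_of_lt {x : ℝ} (hx : x < φ) :
    SignType.sign (firstTaylor g φ x) =
      SignType.sign (iteratedDeriv (firstOrder g φ) g φ) * (-1) ^ firstOrder g φ := by
  rw [firstTaylor, sign_mul, sign_pow, sign_neg (sub_neg.2 hx), div_eq_mul_inv, sign_mul,
    sign_pos (inv_pos.2 (by positivity)), mul_one]

theorem goodRadius_of_two_mul_le (hg : ContDiff ℝ ∞ g) (hd : 0 < firstOrder g φ) {M ε : ℝ}
    (hM : ∀ x, |iteratedDeriv (firstOrder g φ + 1) g x| ≤ M)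
    (hε : 2 * M * ε ≤ |iteratedDeriv (firstOrder g φ) g φ|) : GoodRadius g φ ε := by
  have abs_sub_le {x : ℝ} (hx : x ∈ Set.Ioo (φ - ε) (φ + ε)) : |x - φ| ≤ ε :=
    abs_le.2 ⟨by linarith [hx.1], by linarith [hx.2]⟩
  have sign_deriv {x : ℝ} (hx : x ∈ Set.Ioo (φ - ε) (φ + ε)) :
      SignType.sign (deriv g x) = SignType.sign (firstTaylor (deriv g) φ x) := by
    refine sign_eq_of_abs_sub_le_half (abs_sub_firstTaylor_le_half (M := M) (ε := ε)
      (contDiff_infty_iff_deriv.1 hg).2 ?_ ?_ (abs_sub_le hx))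
    · simpa only [← iteratedDeriv_succ', firstOrder_deriv_add_one hd] using hM
    · simpa only [← iteratedDeriv_succ', firstOrder_deriv_add_one hd] using hε
  exact
    { sign_right := fun x hx y hy => by
        rw [sign_deriv ⟨by linarith [hx.1, hx.2], hx.2⟩,
          sign_deriv ⟨by linarith [hy.1, hy.2], hy.2⟩,
          sign_firstTaylor_of_gt hx.1, sign_firstTaylor_of_gt hy.1]
      sign_left := fun x hx y hy => by
        rw [sign_deriv ⟨hx.1, by linarith [hx.1, hx.2]⟩,
          sign_deriv ⟨hy.1, by linarith [hy.1, hy.2]⟩,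
          sign_firstTaylor_of_lt hx.2, sign_firstTaylor_of_lt hy.2]
      approx := fun x hx => abs_sub_firstTaylor_le_half hg hM hε (abs_sub_le hx)
      sign_deriv := fun x hx => by rw [sign_deriv hx, deriv_firstTaylor hd] }

end Taylor

section NumberField

open Polynomial IntermediateField ComplexConjugate

theorem finrank_sup_map_le {F K : Type*} [Field F] [Field K] [Algebra F K]
    (E : IntermediateField F K) (σ : K →ₐ[F] K) :
    Module.finrank F ↥(E ⊔ E.map σ) ≤ Module.finrank F E ^ 2 := by
  rw [sq]
  exact (finrank_sup_le E (E.map σ)).trans_eq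
    (congrArg _ (E.equivMap σ).toLinearEquiv.finrank_eq.symm)

theorem exists_intermediateField_of_eval_eq_zero {F K : Type*} [Field F] [Field K] [Algebra F K]
    (E : IntermediateField F K) [FiniteDimensional F E] {P : E[X]} (hP : P ≠ 0) {z : K}
    (hz : aeval z P = 0) :
    ∃ L : IntermediateField F K, FiniteDimensional F L ∧
      Module.finrank F L ≤ Module.finrank F E * P.natDegree ∧ E ≤ L ∧ z ∈ L := by
  have isIntegral_z : IsIntegral E z := isAlgebraic_iff_isIntegral.1 ⟨P, hP, hz⟩
  have : FiniteDimensional E E⟮z⟯ := adjoin.finiteDimensional isIntegral_z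
  have : Module.Free E E⟮z⟯ := Module.Free.of_divisionRing _ _
  refine ⟨E⟮z⟯.restrictScalars F, FiniteDimensional.trans F E E⟮z⟯, ?_,
    fun x hx => E⟮z⟯.algebraMap_mem ⟨x, hx⟩, mem_adjoin_simple_self E z⟩
  calc Module.finrank F E⟮z⟯ = Module.finrank F E * (minpoly E z).natDegree := by
        rw [← Module.finrank_mul_finrank F E E⟮z⟯, adjoin.finrank isIntegral_z]
    _ ≤ Module.finrank F E * P.natDegree :=
        Nat.mul_le_mul_left _ (natDegree_le_of_dvd (minpoly.dvd E z hz) hP)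

theorem exists_numberField_of_eval_circlePoly_eq_zero {k : ℕ} {β : Fin (k + 1) → ℂ}
    (hβ : ∀ m, IsIntegral ℚ (β m)) (hP : circlePoly β (conj ∘ β) ≠ 0) {z : ℂ}
    (hz : (circlePoly β (conj ∘ β)).eval z = 0) :
    ∃ L : IntermediateField ℚ ℂ, NumberField L ∧
      Module.finrank ℚ L ≤ Module.finrank ℚ (adjoin ℚ (Set.range β)) ^ 2 * (2 * k) ∧
      (∀ m, β m ∈ L ∧ conj (β m) ∈ L) ∧ z ∈ L := by
  set E := adjoin ℚ (Set.range β)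
  let σ : ℂ →ₐ[ℚ] ℂ := (conj : ℂ →+* ℂ).toRatAlgHom
  have : FiniteDimensional ℚ E := finiteDimensional_adjoin fun x hx => by
    obtain ⟨m, rfl⟩ := hx
    exact hβ m
  have : FiniteDimensional ℚ (E.map σ) := (E.equivMap σ).toLinearEquiv.finiteDimensional
  have mem_left (m) : β m ∈ E ⊔ E.map σ :=
    (le_sup_left : E ≤ _) (subset_adjoin _ _ (Set.mem_range_self m))
  have mem_right (m) : conj (β m) ∈ E ⊔ E.map σ :=
    (le_sup_right : E.map σ ≤ _) ⟨_, subset_adjoin _ _ (Set.mem_range_self m), rfl⟩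
  let P : (E ⊔ E.map σ : IntermediateField ℚ ℂ)[X] :=
    circlePoly (fun m => ⟨β m, mem_left m⟩) (fun m => ⟨conj (β m), mem_right m⟩)
  have map_P : P.map (algebraMap _ ℂ) = circlePoly β (conj ∘ β) := map_circlePoly _ _ _
  obtain ⟨L, finite_L, finrank_L, le_L, z_mem⟩ :=
    exists_intermediateField_of_eval_eq_zero (E ⊔ E.map σ) (P := P) (z := z)
      (fun h => hP (by rw [← map_P, h, Polynomial.map_zero]))
      (by rw [← eval_map_algebraMap, map_P, hz])
  refine ⟨L, { to_finiteDimensional := finite_L }, finrank_L.trans ?_,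
    fun m => ⟨le_L (mem_left m), le_L (mem_right m)⟩, z_mem⟩
  exact Nat.mul_le_mul (finrank_sup_map_le E σ) (natDegree_circlePoly_le _ _)

end NumberField

section Separation

open Polynomial NumberField

variable {K : Type*} [Field K] [NumberField K] {k : ℕ} {B : ℝ}

theorem house_coeff_iterate_eulerOp_circlePoly_le {b c : Fin (k + 1) → 𝓞 K}
    (hb : ∀ m, house (b m : K) ≤ B) (hc : ∀ m, house (c m : K) ≤ B) (n j : ℕ) :
    house (((eulerOp k)^[n] (circlePoly b c)).coeff j : K) ≤ k ^ n * (2 * (k + 1) * B) :=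
  house_le fun σ => by
    let f : 𝓞 K →+* ℂ := σ.comp (algebraMap (𝓞 K) K)
    rw [← RingHom.comp_apply, ← coeff_map f, map_iterate_eulerOp, map_circlePoly]
    exact norm_coeff_iterate_eulerOp_le (natDegree_circlePoly_le _ _)
      (norm_coeff_circlePoly_le (fun m => (norm_embedding_le_house _ σ).trans (hb m))
        fun m => (norm_embedding_le_house _ σ).trans (hc m)) n j

theorem one_le_norm_aeval_iterate_eulerOp_circlePoly_mul_pow {b c : Fin (k + 1) → 𝓞 K}
    (hb : ∀ m, house (b m : K) ≤ B) (hc : ∀ m, house (c m : K) ≤ B) {H : ℝ}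
    (hH : ∀ n ≤ 2 * k, k ^ n * (2 * (k + 1) * B) ≤ H) {z : K}
    (hP : circlePoly b c ≠ 0) (hz : aeval z (circlePoly b c) = 0) {n : ℕ} (hn : n ≤ 2 * k)
    (hQz : aeval z ((eulerOp k)^[n] (circlePoly b c)) ≠ 0) (τ : K →+* ℂ) :
    1 ≤ ‖τ (aeval z ((eulerOp k)^[n] (circlePoly b c)))‖ *
      (((2 * k : ℕ) + 1) * (2 * H) ^ (2 * k + 1)) ^ Module.finrank ℚ K := by
  have house_coeff_le {l : ℕ} (hl : l ≤ 2 * k) (j : ℕ) :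
      house (((eulerOp k)^[l] (circlePoly b c)).coeff j : K) ≤ H :=
    (house_coeff_iterate_eulerOp_circlePoly_le hb hc l j).trans (hH l hl)
  have natDegree_le : ((eulerOp k)^[n] (circlePoly b c)).natDegree ≤ 2 * k :=
    natDegree_iterate_eulerOp_le (natDegree_circlePoly_le b c) n
  have house_coeff_circlePoly_le (j : ℕ) : house ((circlePoly b c).coeff j : K) ≤ H :=
    house_coeff_le (Nat.zero_le _) j
  refine one_le_norm_aeval_mul_pow hP hz natDegree_le ?_ (house_coeff_le hn) hQz τ
  exact house_coeff_circlePoly_le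

theorem one_le_norm_add_one_mul_pow {P : (𝓞 K)[X]} (hP : P ≠ 0) {N : ℕ} (hN : 1 ≤ N)
    {H : ℝ} (hH : ∀ j, house (P.coeff j : K) ≤ H) {z : K} (hz : aeval z P = 0) (hz1 : z + 1 ≠ 0)
    (τ : K →+* ℂ) :
    1 ≤ ‖τ (z + 1)‖ * ((N + 1) * (2 * H) ^ (N + 1)) ^ Module.finrank ℚ K := by
  have one_le_H : 1 ≤ H := (one_le_house_of_isIntegral (RingOfIntegers.isIntegral_coe _)
    (RingOfIntegers.coe_ne_zero_iff.2 (leadingCoeff_ne_zero.2 hP))).trans (hH P.natDegree)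
  have house_coeff_le (j : ℕ) : house (((X + 1 : (𝓞 K)[X]).coeff j : 𝓞 K) : K) ≤ H := by
    refine le_trans (house_le fun σ => ?_) one_le_H
    rcases j with _ | _ | j <;> simp [coeff_X, coeff_one]
  have natDegree_le : (X + 1 : (𝓞 K)[X]).natDegree ≤ N := (natDegree_X_add_C (1 : 𝓞 K)).trans_le hN
  have aeval_eq : aeval z (X + 1 : (𝓞 K)[X]) = z + 1 := by simp
  rw [← aeval_eq] at hz1 ⊢
  exact one_le_norm_aeval_mul_pow hP hz natDegree_le hH house_coeff_le hz1 τ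

end Separation

section Model

open Polynomial NumberField IntermediateField ComplexConjugate

theorem conj_mem_rootSet {p : ℤ[X]} {z : ℂ} (hz : z ∈ p.rootSet ℂ) : conj z ∈ p.rootSet ℂ := by
  obtain ⟨hp, hz⟩ := mem_rootSet.1 hz
  refine mem_rootSet.2 ⟨hp, ?_⟩
  rw [← (conj : ℂ →+* ℂ).toIntAlgHom_apply, aeval_algHom_apply, hz, map_zero]

theorem house_intCast_mul_le_of_mem_rootSet {K : Type*} [Field K] [NumberField K] {p : ℤ[X]}
    {N l : ℕ} (hp : ∀ i, |p.coeff i| ≤ 2 ^ N) {A : ℤ} (hA : |A| ≤ 2 ^ l) {x : K}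
    (hx : x ∈ p.rootSet K) : house (A * x) ≤ 2 ^ (l + (N + 1)) := by
  rw [pow_add]
  refine (house_mul_le _ _).trans (mul_le_mul ?_ (house_le_of_mem_rootSet hp hx) (house_nonneg _)
    (by positivity))
  rw [house_intCast]
  exact_mod_cast hA

theorem isIntegral_rat_of_mem_rootSet {p : ℤ[X]} {z : ℂ} (hz : z ∈ p.rootSet ℂ) :
    IsIntegral ℚ z := by
  obtain ⟨hp, hz⟩ := mem_rootSet.1 hz
  have isAlgebraic : IsAlgebraic ℤ z := ⟨p, hp, hz⟩
  exact (isAlgebraic.extendScalars (algebraMap ℤ ℚ).injective_int).isIntegral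

variable {k N : ℕ} {p : Fin (k + 1) → ℤ[X]} {β : Fin (k + 1) → ℂ} {z : ℂ}

theorem exists_integral_circlePoly (hp : ∀ m i, |(p m).coeff i| ≤ 2 ^ N)
    (hβ : ∀ m, β m ∈ (p m).rootSet ℂ) (hP : circlePoly β (conj ∘ β) ≠ 0)
    (hz : (circlePoly β (conj ∘ β)).eval z = 0) :
    ∃ (L : IntermediateField ℚ ℂ) (_ : NumberField L) (A : ℤ) (b c : Fin (k + 1) → 𝓞 L),
      Module.finrank ℚ L ≤ Module.finrank ℚ (adjoin ℚ (Set.range β)) ^ 2 * (2 * k) ∧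
      z ∈ L ∧ A ≠ 0 ∧ |A| ≤ 2 ^ (N * (k + 1)) ∧
      (circlePoly b c).map (algebraMap (𝓞 L) ℂ) = C (A : ℂ) * circlePoly β (conj ∘ β) ∧
      ∀ m, house (b m : L) ≤ 2 ^ (N * (k + 1) + (N + 1)) ∧
        house (c m : L) ≤ 2 ^ (N * (k + 1) + (N + 1)) := by
  obtain ⟨L, numberField_L, finrank_L, mem_L, z_mem⟩ :=
    exists_numberField_of_eval_circlePoly_eq_zero
      (fun m => isIntegral_rat_of_mem_rootSet (hβ m)) hP hz
  set A := ∏ m, (p m).leadingCoeff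
  have A_ne_zero : A ≠ 0 := Finset.prod_ne_zero_iff.2 fun m _ =>
    leadingCoeff_ne_zero.2 (mem_rootSet.1 (hβ m)).1
  have abs_A_le : |A| ≤ 2 ^ (N * (k + 1)) := by
    simpa using abs_prod_leadingCoeff_le hp
  have mem_rootSet_L {m : Fin (k + 1)} {x : L} (hx : (x : ℂ) ∈ (p m).rootSet ℂ) :
      x ∈ (p m).rootSet L :=
    mem_rootSet.2 ⟨(mem_rootSet.1 hx).1,
      (aeval_algebraMap_eq_zero_iff ℂ x _).1 (mem_rootSet.1 hx).2⟩
  have b_mem (m) : (⟨β m, (mem_L m).1⟩ : L) ∈ (p m).rootSet L := mem_rootSet_L (hβ m)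
  have c_mem (m) : (⟨conj (β m), (mem_L m).2⟩ : L) ∈ (p m).rootSet L :=
    mem_rootSet_L (conj_mem_rootSet (hβ m))
  refine ⟨L, numberField_L, A,
    fun m => ⟨_, isIntegral_prod_leadingCoeff_mul (mem_rootSet.1 (b_mem m)).2⟩,
    fun m => ⟨_, isIntegral_prod_leadingCoeff_mul (mem_rootSet.1 (c_mem m)).2⟩,
    finrank_L, z_mem, A_ne_zero, abs_A_le, ?_, fun m =>
    ⟨house_intCast_mul_le_of_mem_rootSet (hp m) abs_A_le (b_mem m),
      house_intCast_mul_le_of_mem_rootSet (hp m) abs_A_le (c_mem m)⟩⟩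
  exact (map_circlePoly _ _ _).trans (circlePoly_mul (A : ℂ) β (conj ∘ β))

end Model

section Bounds

theorem two_mul_le_two_pow (N : ℕ) : 2 * N ≤ 2 ^ N := by
  rcases N with _ | N
  · simp
  · rw [pow_succ']
    exact Nat.mul_le_mul_left 2 Nat.lt_two_pow_self

variable {k n N : ℕ}

theorem natCast_pow_le_two_pow (hk : k ≤ N) (n : ℕ) : (k : ℝ) ^ n ≤ 2 ^ (N * n) := by
  rw [pow_mul]
  have : k ≤ 2 ^ N := hk.trans Nat.lt_two_pow_self.le
  gcongr
  exact_mod_cast this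

theorem two_mul_succ_le_two_pow (hk : k < N) : 2 * ((k : ℝ) + 1) ≤ 2 ^ N := by
  exact_mod_cast (Nat.mul_le_mul_left 2 hk).trans (two_mul_le_two_pow N)

theorem pow_mul_two_pow_le (hk : k < N) (hn : n ≤ 2 * k) :
    (k : ℝ) ^ n * (2 * (k + 1) * 2 ^ (N * (k + 1) + (N + 1))) ≤ 2 ^ (4 * N ^ 2) := by
  calc (k : ℝ) ^ n * (2 * (k + 1) * 2 ^ (N * (k + 1) + (N + 1)))
      ≤ 2 ^ (N * n) * (2 ^ N * 2 ^ (N * (k + 1) + (N + 1))) := by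
        gcongr
        exacts [natCast_pow_le_two_pow hk.le n, two_mul_succ_le_two_pow hk]
    _ = 2 ^ (N * n + (N + (N * (k + 1) + (N + 1)))) := by simp only [pow_add]
    _ ≤ 2 ^ (4 * N ^ 2) := pow_le_pow_right₀ one_le_two (by nlinarith)

theorem mul_pow_pow_le_two_pow {D r : ℕ} (hk : k < N) (hr : r ≤ D ^ 2 * (2 * k)) :
    (((2 * k : ℕ) + 1) * (2 * 2 ^ (4 * N ^ 2)) ^ (2 * k + 1) : ℝ) ^ r ≤
      2 ^ (16 * D ^ 2 * N ^ 4) := by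
  have two_mul_add_one_le : ((2 * k : ℕ) + 1 : ℝ) ≤ 2 ^ N := by
    push_cast
    linarith [two_mul_succ_le_two_pow hk]
  calc (((2 * k : ℕ) + 1) * (2 * 2 ^ (4 * N ^ 2)) ^ (2 * k + 1) : ℝ) ^ r
      ≤ (2 ^ N * (2 * 2 ^ (4 * N ^ 2)) ^ (2 * k + 1)) ^ r := by gcongr
    _ = 2 ^ ((N + (4 * N ^ 2 + 1) * (2 * k + 1)) * r) := by
        rw [← pow_succ', ← pow_mul, ← pow_add, ← pow_mul]
    _ ≤ 2 ^ (8 * N ^ 3 * (D ^ 2 * (2 * N))) := by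
        refine pow_le_pow_right₀ one_le_two (Nat.mul_le_mul ?_ (hr.trans ?_))
        · nlinarith [Nat.mul_le_mul_left (4 * N ^ 2 + 1) (by omega : 2 * k + 2 ≤ 2 * N),
            Nat.mul_le_mul_right N (by omega : 1 ≤ N)]
        · gcongr
    _ = 2 ^ (16 * D ^ 2 * N ^ 4) := by ring_nf

theorem two_mul_mul_pow_mul_le_two_pow (hk : k < N) (hn : n ≤ 2 * k) :
    2 * ((2 * k + 1) * (k ^ (n + 1) * (2 * (k + 1) * 2 ^ (N + 1)))) ≤ (2 : ℝ) ^ (6 * N ^ 2) := by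
  calc 2 * ((2 * k + 1) * (k ^ (n + 1) * (2 * (k + 1) * 2 ^ (N + 1))))
      ≤ (2 : ℝ) * (2 ^ N * (2 ^ (N * (n + 1)) * (2 ^ N * 2 ^ (N + 1)))) := by
        gcongr
        · linarith [two_mul_succ_le_two_pow hk]
        · exact natCast_pow_le_two_pow hk.le _
        · exact two_mul_succ_le_two_pow hk
    _ = 2 ^ (1 + (N + (N * (n + 1) + (N + (N + 1))))) := by simp only [pow_add, pow_one]
    _ ≤ 2 ^ (6 * N ^ 2) := by
        refine pow_le_pow_right₀ one_le_two ?_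
        nlinarith [Nat.mul_le_mul_left N (by omega : n + 2 ≤ 2 * N),
            Nat.mul_le_mul_right N (by omega : 1 ≤ N)]

end Bounds

section ComplexSeparation

open Polynomial NumberField IntermediateField ComplexConjugate

variable {k N D : ℕ} {p : Fin (k + 1) → ℤ[X]} {β : Fin (k + 1) → ℂ} {z : ℂ}

theorem algebraMap_aeval_ringOfIntegers (L : IntermediateField ℚ ℂ) (x : L) (Q : (𝓞 L)[X]) :
    algebraMap L ℂ (aeval x Q) = (Q.map (algebraMap (𝓞 L) ℂ)).eval (x : ℂ) := by
  rw [eval_map_algebraMap]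
  exact (aeval_algebraMap_apply ℂ x Q).symm

theorem ne_zero_of_map_eq_C_mul {R S : Type*} [CommRing R] [CommRing S] [NoZeroDivisors S]
    {f : R →+* S} {Q : R[X]} {P : S[X]} {a : S} (hQ : Q.map f = C a * P) (ha : a ≠ 0)
    (hP : P ≠ 0) : Q ≠ 0 := by
  rintro rfl
  rw [Polynomial.map_zero] at hQ
  exact mul_ne_zero (C_ne_zero.2 ha) hP hQ.symm

theorem one_le_norm_eval_iterate_eulerOp_mul_two_pow (hp : ∀ m i, |(p m).coeff i| ≤ 2 ^ N)
    (hβ : ∀ m, β m ∈ (p m).rootSet ℂ) (hP : circlePoly β (conj ∘ β) ≠ 0)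
    (hz : (circlePoly β (conj ∘ β)).eval z = 0) (hk : k < N)
    (hD : Module.finrank ℚ (adjoin ℚ (Set.range β)) ≤ D) {n : ℕ} (hn : n ≤ 2 * k)
    (hQz : ((eulerOp k)^[n] (circlePoly β (conj ∘ β))).eval z ≠ 0) :
    1 ≤ ‖((eulerOp k)^[n] (circlePoly β (conj ∘ β))).eval z‖ *
      2 ^ (N ^ 2 + 16 * D ^ 2 * N ^ 4) := by
  obtain ⟨L, _, A, b, c, finrank_L, z_mem, A_ne_zero, abs_A_le, map_bc, house_le⟩ :=
    exists_integral_circlePoly hp hβ hP hz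
  have A_ne_zero : (A : ℂ) ≠ 0 := Int.cast_ne_zero.2 A_ne_zero
  have algebraMap_aeval (l : ℕ) :
      algebraMap L ℂ (aeval ⟨z, z_mem⟩ ((eulerOp k)^[l] (circlePoly b c))) =
        A * ((eulerOp k)^[l] (circlePoly β (conj ∘ β))).eval z := by
    rw [algebraMap_aeval_ringOfIntegers, map_iterate_eulerOp, map_bc, iterate_eulerOp_C_mul,
      eval_C_mul]
  have separation := one_le_norm_aeval_iterate_eulerOp_circlePoly_mul_pow
    (fun m => (house_le m).1) (fun m => (house_le m).2) (fun l hl => pow_mul_two_pow_le hk hl)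
    (ne_zero_of_map_eq_C_mul map_bc A_ne_zero hP)
    ((map_eq_zero _).1 ((algebraMap_aeval 0).trans (mul_eq_zero_of_right _ hz))) hn
    ((_root_.map_ne_zero _).1 ((algebraMap_aeval n).trans_ne (mul_ne_zero A_ne_zero hQz)))
    (algebraMap L ℂ)
  rw [algebraMap_aeval, norm_mul, mul_comm ‖(A : ℂ)‖, mul_assoc] at separation
  have norm_A_le : ‖(A : ℂ)‖ ≤ 2 ^ N ^ 2 := by
    rw [Complex.norm_intCast]
    calc |(A : ℝ)| ≤ 2 ^ (N * (k + 1)) := by exact_mod_cast abs_A_le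
      _ ≤ 2 ^ N ^ 2 := pow_le_pow_right₀ one_le_two (by nlinarith)
  refine separation.trans (mul_le_mul_of_nonneg_left ?_ (norm_nonneg _))
  have finrank_le : Module.finrank ℚ L ≤ D ^ 2 * (2 * k) := finrank_L.trans (by gcongr)
  exact (mul_le_mul norm_A_le (mul_pow_pow_le_two_pow hk finrank_le) (by positivity)
    (by positivity)).trans_eq (pow_add _ _ _).symm

theorem one_le_norm_add_one_mul_two_pow (hp : ∀ m i, |(p m).coeff i| ≤ 2 ^ N)
    (hβ : ∀ m, β m ∈ (p m).rootSet ℂ) (hP : circlePoly β (conj ∘ β) ≠ 0)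
    (hz : (circlePoly β (conj ∘ β)).eval z = 0) (hk : k < N)
    (hD : Module.finrank ℚ (adjoin ℚ (Set.range β)) ≤ D) (hz1 : z + 1 ≠ 0) :
    1 ≤ ‖z + 1‖ * 2 ^ (16 * D ^ 2 * N ^ 4) := by
  obtain ⟨L, _, A, b, c, finrank_L, z_mem, A_ne_zero, -, map_bc, house_le⟩ :=
    exists_integral_circlePoly hp hβ hP hz
  have aeval_eq_zero : aeval (⟨z, z_mem⟩ : L) (circlePoly b c) = 0 := by
    rw [← map_eq_zero (algebraMap L ℂ), algebraMap_aeval_ringOfIntegers, map_bc, eval_C_mul, hz,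
      mul_zero]
  have one_le_two_mul : 1 ≤ 2 * k := Nat.one_le_iff_ne_zero.2 fun h => by
    rw [h, mul_zero] at finrank_L
    exact Module.finrank_pos.not_ge finrank_L
  refine (one_le_norm_add_one_mul_pow
    (ne_zero_of_map_eq_C_mul map_bc (Int.cast_ne_zero.2 A_ne_zero) hP) one_le_two_mul
    (fun j => (house_coeff_iterate_eulerOp_circlePoly_le (fun m => (house_le m).1)
      (fun m => (house_le m).2) 0 j).trans (pow_mul_two_pow_le hk (Nat.zero_le _)))
    aeval_eq_zero (fun h => hz1 (congrArg (algebraMap L ℂ) h)) (algebraMap L ℂ)).trans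
    (mul_le_mul_of_nonneg_left ?_ (norm_nonneg _))
  exact mul_pow_pow_le_two_pow hk (finrank_L.trans (by gcongr))

end ComplexSeparation

section Encoding

open Computability

theorem lt_two_pow_length_encodePosNum (m : PosNum) : (m : ℕ) < 2 ^ (encodePosNum m).length := by
  induction m with
  | one => simp [encodePosNum]
  | bit1 m ih =>
    rw [encodePosNum, List.length_cons, pow_succ, PosNum.cast_bit1]
    omega
  | bit0 m ih =>
    rw [encodePosNum, List.length_cons, pow_succ, PosNum.cast_bit0]
    omega

theorem lt_two_pow_length_encodeNat (n : ℕ) : n < 2 ^ (encodeNat n).length := by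
  have lt_encodeNum : ∀ m : Num, (m : ℕ) < 2 ^ (encodeNum m).length
    | .zero => by simp [encodeNum]
    | .pos m => lt_two_pow_length_encodePosNum m
  simpa [encodeNat] using lt_encodeNum n

theorem length_encodeInt (z : ℤ) :
    (encodeInt z).length = 2 * (encodeNat z.natAbs).length + 4 := by
  simp [encodeInt, digit, comma, List.length_flatMap]
  ring

theorem abs_le_two_pow_length_encodeInt (z : ℤ) : |z| ≤ 2 ^ (encodeInt z).length := by
  have length_le : (encodeNat z.natAbs).length ≤ (encodeInt z).length := by
    rw [length_encodeInt]
    omega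
  rw [Int.abs_eq_natAbs]
  exact_mod_cast (lt_two_pow_length_encodeNat z.natAbs).le.trans
    (Nat.pow_le_pow_right two_pos length_le)

theorem length_le_length_flatMap_of_mem {α β : Type*} {l : List α} {x : α} (hx : x ∈ l)
    (f : α → List β) : (f x).length ≤ (l.flatMap f).length := by
  rw [List.length_flatMap]
  exact List.le_sum_of_mem (List.mem_map_of_mem hx)

theorem abs_coeff_le_two_pow_length_encodePoly (p : Polynomial ℤ) (i : ℕ) :
    |p.coeff i| ≤ 2 ^ (encodePoly p).length := by
  rcases lt_or_ge p.natDegree i with hi | hi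
  · rw [Polynomial.coeff_eq_zero_of_natDegree_lt hi, abs_zero]
    positivity
  · refine (abs_le_two_pow_length_encodeInt _).trans (pow_le_pow_right₀ one_le_two ?_)
    rw [encodePoly, List.length_append]
    exact le_add_right (length_le_length_flatMap_of_mem (List.mem_range.2 (Nat.lt_succ_of_le hi))
      fun i => encodeInt (p.coeff i))

theorem abs_coeff_poly_le_two_pow_size (F : FunRep) (m : Fin (F.k + 1)) (i : ℕ) :
    |(F.coeff m).poly.coeff i| ≤ 2 ^ F.size := by
  refine (abs_coeff_le_two_pow_length_encodePoly _ i).trans (pow_le_pow_right₀ one_le_two ?_)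
  calc (encodePoly (F.coeff m).poly).length
      ≤ (encodeAlgRep (F.coeff m)).length := by
        simp only [encodeAlgRep, List.length_append]
        omega
    _ ≤ F.size := length_le_length_flatMap_of_mem (List.mem_ofFn.2 ⟨m, rfl⟩) encodeAlgRep

theorem k_lt_size (F : FunRep) : F.k < F.size := by
  have one_le_length_encodeAlgRep (R : AlgRep) : 1 ≤ (encodeAlgRep R).length := by
    simp only [encodeAlgRep, encodeRat, List.length_append, length_encodeInt]
    omega
  have := List.length_le_sum_of_one_le ((List.ofFn F.coeff).map fun R => (encodeAlgRep R).length)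
    fun l hl => by
      obtain ⟨R, -, rfl⟩ := List.mem_map.1 hl
      exact one_le_length_encodeAlgRep R
  rwa [List.length_map, List.length_ofFn, ← List.length_flatMap] at this

end Encoding

section Distance

open Complex

theorem norm_exp_mul_I_sub_exp_mul_I_le (x y : ℝ) :
    ‖exp (x * I) - exp (y * I)‖ ≤ |x - y| := by
  have eq : exp (x * I) - exp (y * I) = exp (y * I) * (exp (I * (x - y : ℝ)) - 1) := by
    rw [mul_sub, mul_one, ← exp_add]
    congr 2
    push_cast
    ring
  rw [eq, norm_mul, norm_exp_ofReal_mul_I, one_mul]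
  exact Real.norm_exp_I_mul_ofReal_sub_one_le

theorem Ioo_subset_of_le_norm_exp_mul_I_add_one {φ ε : ℝ}
    (hφ : φ ∈ Set.Icc (-Real.pi) Real.pi) (hε : ε ≤ ‖exp (φ * I) + 1‖) :
    Set.Ioo (φ - ε) (φ + ε) ⊆ Set.Ioo (-Real.pi) Real.pi := by
  have le_pi_sub : ε ≤ Real.pi - φ := by
    have := norm_exp_mul_I_sub_exp_mul_I_le φ Real.pi
    rw [exp_pi_mul_I, sub_neg_eq_add, abs_sub_comm, abs_of_nonneg (sub_nonneg.2 hφ.2)] at this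
    exact hε.trans this
  have le_sub_neg_pi : ε ≤ φ - -Real.pi := by
    have := norm_exp_mul_I_sub_exp_mul_I_le φ (-Real.pi)
    rw [ofReal_neg, neg_mul, exp_neg_pi_mul_I, sub_neg_eq_add,
      abs_of_nonneg (sub_nonneg.2 hφ.1)] at this
    exact hε.trans this
  exact Set.Ioo_subset_Ioo (by linarith) (by linarith)

theorem exp_mul_I_add_one_ne_zero {φ : ℝ} (hφ : φ ∈ Set.Ioo (-Real.pi) Real.pi) :
    exp (φ * I) + 1 ≠ 0 := fun h => by
  have arg_eq : arg (exp (φ * I)) = arg (-1) := by rw [eq_neg_of_add_eq_zero_left h]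
  rw [arg_neg_one, arg_exp_mul_I, (toIocMod_eq_self Real.two_pi_pos).2
    ⟨hφ.1, by linarith [hφ.2]⟩] at arg_eq
  exact hφ.2.ne arg_eq

end Distance

section CircleFun

open Polynomial ComplexConjugate

variable {k N D : ℕ} {p : Fin (k + 1) → ℤ[X]} {β : Fin (k + 1) → ℂ} {φ ε : ℝ}

theorem eval_circlePoly_eq_zero (hφ : circleFun β φ = 0) :
    (circlePoly β (conj ∘ β)).eval (Complex.exp (φ * Complex.I)) = 0 := by
  rw [circlePoly_eval_of_norm_eq_one β (Complex.norm_exp_ofReal_mul_I φ)]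
  exact mul_eq_zero_of_right _ (Complex.ofReal_eq_zero.2 hφ)

theorem one_le_abs_iteratedDeriv_circleFun_mul_two_pow (hp : ∀ m i, |(p m).coeff i| ≤ 2 ^ N)
    (hβ : ∀ m, β m ∈ (p m).rootSet ℂ) (hk : k < N)
    (hD : Module.finrank ℚ (IntermediateField.adjoin ℚ (Set.range β)) ≤ D)
    (hne : ∃ m : Fin (k + 1), 1 ≤ (m : ℕ) ∧ β m ≠ 0) (hφ : circleFun β φ = 0) {n : ℕ}
    (hn : n ≤ 2 * k) (hg : iteratedDeriv n (circleFun β) φ ≠ 0) :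
    1 ≤ |iteratedDeriv n (circleFun β) φ| * 2 ^ (N ^ 2 + 16 * D ^ 2 * N ^ 4) := by
  obtain ⟨m, hm, hβm⟩ := hne
  rw [← abs_ne_zero] at hg
  rw [abs_iteratedDeriv_circleFun] at hg ⊢
  exact one_le_norm_eval_iterate_eulerOp_mul_two_pow hp hβ (circlePoly_ne_zero _ hm hβm)
    (eval_circlePoly_eq_zero hφ) hk hD hn (norm_ne_zero_iff.1 hg)

theorem goodRadius_circleFun (hp : ∀ m i, |(p m).coeff i| ≤ 2 ^ N)
    (hβ : ∀ m, β m ∈ (p m).rootSet ℂ) (hk : k < N)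
    (hD : Module.finrank ℚ (IntermediateField.adjoin ℚ (Set.range β)) ≤ D)
    (hne : ∃ m : Fin (k + 1), 1 ≤ (m : ℕ) ∧ β m ≠ 0) (hφ : circleFun β φ = 0) (hε₀ : 0 ≤ ε)
    (hε : ε * 2 ^ (7 * N ^ 2 + 16 * D ^ 2 * N ^ 4) ≤ 1) : GoodRadius (circleFun β) φ ε := by
  have ⟨m, hm, hβm⟩ := hne
  obtain ⟨n, hn, hgn⟩ := exists_le_iteratedDeriv_circleFun_ne_zero hm hβm φ
  have firstOrder_le : firstOrder (circleFun β) φ ≤ 2 * k := (Nat.sInf_le hgn).trans hn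
  refine goodRadius_of_two_mul_le (contDiff_circleFun β) (firstOrder_pos hgn hφ)
    (abs_iteratedDeriv_circleFun_le (fun m => norm_le_of_mem_rootSet (hp m) (hβ m)) _)
    (le_of_mul_le_mul_right ?_ (by positivity : (0 : ℝ) < 2 ^ (N ^ 2 + 16 * D ^ 2 * N ^ 4)))
  have two_mul_le := two_mul_mul_pow_mul_le_two_pow hk firstOrder_le
  set d := firstOrder (circleFun β) φ
  calc 2 * ((2 * k + 1) * (k ^ (d + 1) * (2 * (k + 1) * 2 ^ (N + 1)))) * ε *
        2 ^ (N ^ 2 + 16 * D ^ 2 * N ^ 4)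
      ≤ 2 ^ (6 * N ^ 2) * ε * 2 ^ (N ^ 2 + 16 * D ^ 2 * N ^ 4) := by gcongr
    _ = ε * 2 ^ (7 * N ^ 2 + 16 * D ^ 2 * N ^ 4) := by ring
    _ ≤ 1 := hε
    _ ≤ |iteratedDeriv d (circleFun β) φ| * 2 ^ (N ^ 2 + 16 * D ^ 2 * N ^ 4) :=
      one_le_abs_iteratedDeriv_circleFun_mul_two_pow hp hβ hk hD hne hφ firstOrder_le
        (iteratedDeriv_firstOrder_ne_zero hgn)

theorem Ioo_subset_of_circleFun_eq_zero (hp : ∀ m i, |(p m).coeff i| ≤ 2 ^ N)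
    (hβ : ∀ m, β m ∈ (p m).rootSet ℂ) (hk : k < N)
    (hD : Module.finrank ℚ (IntermediateField.adjoin ℚ (Set.range β)) ≤ D)
    (hne : ∃ m : Fin (k + 1), 1 ≤ (m : ℕ) ∧ β m ≠ 0) (hφ : circleFun β φ = 0)
    (hφπ : φ ∈ Set.Ioo (-Real.pi) Real.pi) (hε : ε * 2 ^ (16 * D ^ 2 * N ^ 4) ≤ 1) :
    Set.Ioo (φ - ε) (φ + ε) ⊆ Set.Ioo (-Real.pi) Real.pi := by
  obtain ⟨m, hm, hβm⟩ := hne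
  refine Ioo_subset_of_le_norm_exp_mul_I_add_one (Set.Ioo_subset_Icc_self hφπ)
    (le_of_mul_le_mul_right (hε.trans ?_) (by positivity : (0 : ℝ) < 2 ^ (16 * D ^ 2 * N ^ 4)))
  exact one_le_norm_add_one_mul_two_pow hp hβ (circlePoly_ne_zero _ hm hβm)
    (eval_circlePoly_eq_zero hφ) hk hD (exp_mul_I_add_one_ne_zero hφπ)

theorem exponent_le_pow (hN : 2 ≤ N) (D : ℕ) :
    7 * N ^ 2 + 16 * D ^ 2 * N ^ 4 ≤ N ^ (16 * D ^ 2 + 11) := by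
  calc 7 * N ^ 2 + 16 * D ^ 2 * N ^ 4 ≤ 7 * N ^ 4 + 16 * D ^ 2 * N ^ 4 := by
        gcongr <;> omega
    _ = (16 * D ^ 2 + 7) * N ^ 4 := by ring
    _ ≤ N ^ (16 * D ^ 2 + 7) * N ^ 4 := by gcongr; exact (Nat.lt_pow_self hN).le
    _ = N ^ (16 * D ^ 2 + 11) := (pow_add _ _ _).symm

end CircleFun

end DominantFunction

theorem mainTheorem5_general (D : ℕ) :
    ∃ (ε : DominantFunction.FunRep → ℚ) (C : ℕ),
      Nonempty (Turing.TM2ComputableInPolyTime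
        DominantFunction.encodeFun DominantFunction.encodeRat ε) ∧
      ∀ (F : DominantFunction.FunRep) (β : Fin (F.k + 1) → ℂ),
        (∀ m, β m ∈ (F.coeff m).poly.rootSet ℂ) →
        Module.finrank ℚ (IntermediateField.adjoin ℚ (Set.range β)) ≤ D →
        (∃ m : Fin (F.k + 1), 1 ≤ (m : ℕ) ∧ β m ≠ 0) →
        0 < ε F ∧
        1 / ε F ≤ 2 ^ (F.size ^ C) ∧
        ∀ φ ∈ Set.Ioc (-Real.pi) Real.pi, DominantFunction.circleFun β φ = 0 →
          DominantFunction.GoodRadius (DominantFunction.circleFun β) φ (ε F) ∧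
          (φ < Real.pi →
            Set.Ioo (φ - (ε F : ℝ)) (φ + (ε F : ℝ)) ⊆ Set.Ioo (-Real.pi) Real.pi) := by
  refine ⟨fun F => 1 / 2 ^ (F.size ^ (16 * D ^ 2 + 11)), 16 * D ^ 2 + 11,
    DominantFunction.tm2ComputableInPolyTime_one_div_two_pow _ _,
    fun F β hβ hD hne => ⟨by positivity, by rw [one_div_one_div], fun φ hφ hgφ => ?_⟩⟩
  have k_lt := DominantFunction.k_lt_size F
  have two_le_size : 2 ≤ F.size := by
    obtain ⟨m, hm, -⟩ := hne
    omega
  have coeff_le := DominantFunction.abs_coeff_poly_le_two_pow_size F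
  have mul_two_pow_le {E : ℕ} (hE : E ≤ F.size ^ (16 * D ^ 2 + 11)) :
      ((1 / 2 ^ (F.size ^ (16 * D ^ 2 + 11)) : ℚ) : ℝ) * 2 ^ E ≤ 1 := by
    push_cast
    rw [one_div, inv_mul_le_one₀ (by positivity)]
    exact pow_le_pow_right₀ one_le_two hE
  have exponent_le := DominantFunction.exponent_le_pow two_le_size D
  exact ⟨DominantFunction.goodRadius_circleFun coeff_le hβ k_lt hD hne hgφ (by positivity)
      (mul_two_pow_le exponent_le),
    fun hφπ => DominantFunction.Ioo_subset_of_circleFun_eq_zero coeff_le hβ k_lt hD hne hgφ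
      ⟨hφ.1, hφπ⟩ (mul_two_pow_le ((Nat.le_add_left _ _).trans exponent_le))⟩

theorem mainTheorem5 (D : ℕ) :
    ∃ (ε : DominantFunction.FunRep → ℚ) (C : ℕ),
      Nonempty (Turing.TM2ComputableInPolyTime
        DominantFunction.encodeFun DominantFunction.encodeRat ε) ∧
      ∀ (F : DominantFunction.FunRep) (β : Fin (F.k + 1) → ℂ),
        (∀ m, (F.coeff m).Represents (β m)) →
        Module.finrank ℚ (IntermediateField.adjoin ℚ (Set.range β)) ≤ D →
        (∃ m : Fin (F.k + 1), 1 ≤ (m : ℕ) ∧ β m ≠ 0) →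
        0 < ε F ∧
        1 / ε F ≤ 2 ^ (F.size ^ C) ∧
        ∀ φ ∈ Set.Ioc (-Real.pi) Real.pi, DominantFunction.circleFun β φ = 0 →
          DominantFunction.GoodRadius (DominantFunction.circleFun β) φ (ε F) ∧
          (φ < Real.pi →
            Set.Ioo (φ - (ε F : ℝ)) (φ + (ε F : ℝ)) ⊆ Set.Ioo (-Real.pi) Real.pi) := by
  obtain ⟨ε, C, ε_computable, h⟩ := mainTheorem5_general D
  exact ⟨ε, C, ε_computable, fun F β hβ =>
    h F β fun m => Polynomial.mem_rootSet.2 ⟨(hβ m).1.1, (hβ m).1.2.2.1⟩⟩
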